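/- \textbf{Setting.} Let $H$ be a unital ring. An $H$-algebra is a (not necessarily unital) monoid in the monoidal category of $H$-bimodules with $\otimes_H$; if $H$ is commutative one may instead take only central algebras (left and right action coincide), and everything below holds for either choice. Fix the underlying category $\mathfrak U$ to be sets, (central) $H$-bimodules, or abelian groups, with forgetful functor $F$. A homomorphism is an $F$-split surjection if it has a section in $\mathfrak U$. Let $T(A)$ be the free $H$-algebra on $F(A)$ and $J(A)=\ker(T(A)\to A)$. For a simplicial set $K$ put $A^K=\int_n\prod_{K_n}A\otimes\mathbb Z[t_0,\dots,t_n]/(1-\sum t_i)$, and for pointed $K$ let $A^{(K,*)}=\ker(A^K\to A^*)$. Let $A^{S^1}$ be the ind-algebra $(A^{(\mathrm{sd}^q S^1,*)})_{q\ge 0}$, with $S^1=\Delta^1/\partial\Delta^1$ and transition maps induced by the last vertex maps, and $A^{S^{n+1}}=(A^{S^n})^{S^1}$. Two homomorphisms $A\to B$ are homotopic if they are connected by a chain of elementary homotopies $A\to B[t]$; for an ind-algebra $B=(B_i)$ let $[A,B]=\operatorname{colim}_i[A,B_i]$ be the colimit of the sets of homotopy classes, and let $\{A,B\}=[A,M_\bullet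 M_\infty B]$, where $M_\bullet M_\infty B$ is the ind-algebra $(M_kM_\infty B)_{k\geq 1}$. Define $$kk(A,B)=\operatorname{colim}_n\{J^n(A),B^{S^n}\},$$ the transition maps being $f\mapsto\rho\circ J(f)$ with $\rho$ the (matrix-stabilised) classifying map of the loop extension $A^{(S^1,*)}\to A^{(\Delta^1,*)}\to A$ with the section $a\mapsto a\otimes t$. The sets $kk(A,B)$ are the morphism sets of a category $kk$ whose objects are the $H$-algebras, and each homomorphism $f:A\to B$ has a class $j(f)\in kk(A,B)$. The homomorphism $f$ is a \emph{$kk$-equivalence} if $j(f)$ is invertible in $kk$; $A$ is \emph{$kk$-equivalent to zero} if it is isomorphic to $0$ in $kk$, i.e. if $A\to 0$ is a $kk$-equivalence. An $H$-algebra $A$ is \emph{nilpotent} if $A^m=0$ for some $m\ge 1$, and \emph{$F$-nilpotent} if it is nilpotent and all quotient maps $A^{2^n}\to A^{2^n}/A^{2^{n+1}}$, $n\ge 0$, are $F$-split surjections. \textbf{Theorem.} (1) Let $A=\bigoplus_{n\ge 0}A_n$ be an $\mathbb N$-graded $H$-algebra (the $A_n$ are sub-bimodules with $A_mA_n\subseteq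 A_{m+n}$). Then the inclusion $A_0\to A$ is a $kk$-equivalence. (2) Every $F$-nilpotent $H$-algebra is $kk$-equivalent to zero. -/

import Mathlib

open CategoryTheory MulOpposite TensorProduct

universe u

namespace AlgKK

/-! ### Algebras over a unital ring `H` -/

/-- The two possible choices for the category of `H`-algebras: all of them, or, if `H` is
commutative, only the central ones. -/
inductive AlgClass (H : Type u) [Ring H] : Type u
  | all : AlgClass H
  | central (comm : ∀ x y : H, x * y = y * x) : AlgClass H

/-- The choice of central algebras. -/
def AlgClass.IsCentral {H : Type u} [Ring H] : AlgClass H → Prop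
  | .all => False
  | .central _ => True

/-- A (not necessarily unital) `H`-algebra: a monoid without unit in the monoidal category of
`H`-bimodules with the tensor product over `H`.  The right action of `h` is written
`op h • a`.  The three laws `smul_mul`, `mul_op_smul`, `op_smul_mul` say that the multiplication is
an `H`-bilinear map on the tensor product over `H`. -/
structure HAlg (H : Type u) [Ring H] (c : AlgClass H) : Type (u + 1) where
  carrier : Type u
  [ring : NonUnitalRing carrier]
  [leftModule : Module H carrier]
  [rightModule : Module Hᵐᵒᵖ carrier]
  [smulComm : SMulCommClass H Hᵐᵒᵖ carrier]
  smul_mul : ∀ (h : H) (a b : carrier), (h • a) * b = h • (a * b)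
  mul_op_smul : ∀ (h : H) (a b : carrier), a * (op h • b) = op h • (a * b)
  op_smul_mul : ∀ (h : H) (a b : carrier), (op h • a) * b = a * (h • b)
  op_smul_of_central : c.IsCentral → ∀ (h : H) (a : carrier), op h • a = h • a

namespace HAlg

variable {H : Type u} [Ring H] {c : AlgClass H}

instance : CoeSort (HAlg H c) (Type u) := ⟨HAlg.carrier⟩

attribute [instance] HAlg.ring HAlg.leftModule HAlg.rightModule HAlg.smulComm

/-- Homomorphisms of `H`-algebras. -/
@[ext]
structure Hom (A B : HAlg H c) where
  toFun : A → B
  map_add' : ∀ a b, toFun (a + b) = toFun a + toFun b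
  map_mul' : ∀ a b, toFun (a * b) = toFun a * toFun b
  map_smul' : ∀ (h : H) a, toFun (h • a) = h • toFun a
  map_op_smul' : ∀ (h : H) a, toFun (op h • a) = op h • toFun a

namespace Hom

variable {A B C D : HAlg H c}

instance : FunLike (Hom A B) A B where
  coe := Hom.toFun
  coe_injective f g h := by cases f; cases g; congr

instance : AddMonoidHomClass (Hom A B) A B where
  map_add f := f.map_add'
  map_zero f := by
    have h := f.map_add' 0 0
    rw [add_zero] at h
    exact left_eq_add.mp h

theorem ext' {f g : Hom A B} (h : ∀ a, f a = g a) : f = g := DFunLike.ext _ _ h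

theorem map_mul (f : Hom A B) (a b : A) : f (a * b) = f a * f b := f.map_mul' a b
theorem map_smul (f : Hom A B) (h : H) (a : A) : f (h • a) = h • f a := f.map_smul' h a
theorem map_op_smul (f : Hom A B) (h : H) (a : A) : f (op h • a) = op h • f a :=
  f.map_op_smul' h a

/-- The identity. -/
def id (A : HAlg H c) : Hom A A :=
  ⟨fun a => a, fun _ _ => rfl, fun _ _ => rfl, fun _ _ => rfl, fun _ _ => rfl⟩

/-- Composition `g ∘ f`. -/
def comp (g : Hom B C) (f : Hom A B) : Hom A C where
  toFun a := g (f a)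
  map_add' a b := by rw [map_add f, map_add g]
  map_mul' a b := by rw [f.map_mul, g.map_mul]
  map_smul' h a := by rw [f.map_smul, g.map_smul]
  map_op_smul' h a := by rw [f.map_op_smul, g.map_op_smul]

/-- The zero homomorphism. -/
def zero (A B : HAlg H c) : Hom A B where
  toFun _ := 0
  map_add' _ _ := (add_zero _).symm
  map_mul' _ _ := (mul_zero _).symm
  map_smul' _ _ := (smul_zero _).symm
  map_op_smul' _ _ := (smul_zero _).symm

@[simp] theorem id_apply (a : A) : id A a = a := rfl
@[simp] theorem comp_apply (g : Hom B C) (f : Hom A B) (a : A) : g.comp f a = g (f a) := rfl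
@[simp] theorem zero_apply (a : A) : zero A B a = 0 := rfl

/-- A homomorphism with values in the image of an injective homomorphism factors through it. -/
noncomputable def factor (i : Hom B C) (hi : Function.Injective i) (f : Hom A C)
    (h : ∀ a, ∃ b, i b = f a) : Hom A B where
  toFun a := (h a).choose
  map_add' a b := hi (by
    rw [map_add i, (h _).choose_spec, (h _).choose_spec, (h _).choose_spec, map_add f])
  map_mul' a b := hi (by
    rw [i.map_mul, (h _).choose_spec, (h _).choose_spec, (h _).choose_spec, f.map_mul])
  map_smul' r a := hi (by
    rw [i.map_smul, (h _).choose_spec, (h _).choose_spec, f.map_smul])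
  map_op_smul' r a := hi (by
    rw [i.map_op_smul, (h _).choose_spec, (h _).choose_spec, f.map_op_smul])

theorem factor_spec (i : Hom B C) (hi : Function.Injective i) (f : Hom A C)
    (h : ∀ a, ∃ b, i b = f a) (a : A) : i (factor i hi f h a) = f a := (h a).choose_spec

end Hom

/-- The zero algebra. -/
def zeroAlg (H : Type u) [Ring H] (c : AlgClass H) : HAlg H c where
  carrier := PUnit.{u + 1}
  smul_mul _ _ _ := rfl
  mul_op_smul _ _ _ := rfl
  op_smul_mul _ _ _ := rfl
  op_smul_of_central _ _ _ := rfl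

/-! ### Subalgebras and quotients -/

/-- Subalgebras of an `H`-algebra. -/
structure Sub (A : HAlg H c) extends NonUnitalSubring A where
  smul_mem : ∀ (h : H) (a : A), a ∈ carrier → h • a ∈ carrier
  op_smul_mem : ∀ (h : H) (a : A), a ∈ carrier → op h • a ∈ carrier

namespace Sub

variable {A : HAlg H c} (S : Sub A)

/-- A subalgebra as an algebra. -/
def toHAlg : HAlg H c :=
  letI : SMul H S.toNonUnitalSubring := ⟨fun h a => ⟨h • a.1, S.smul_mem h _ a.2⟩⟩
  letI : SMul Hᵐᵒᵖ S.toNonUnitalSubring := ⟨fun h a => ⟨h • a.1, S.op_smul_mem h.unop _ a.2⟩⟩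
  letI : Module H S.toNonUnitalSubring := Function.Injective.module H
    (S.toNonUnitalSubring.toAddSubgroup.subtype) Subtype.val_injective (fun _ _ => rfl)
  letI : Module Hᵐᵒᵖ S.toNonUnitalSubring := Function.Injective.module Hᵐᵒᵖ
    (S.toNonUnitalSubring.toAddSubgroup.subtype) Subtype.val_injective (fun _ _ => rfl)
  { carrier := S.toNonUnitalSubring
    smulComm := ⟨fun h k a => Subtype.ext (smul_comm h k a.1)⟩
    smul_mul := fun h a b => Subtype.ext (A.smul_mul h a.1 b.1)
    mul_op_smul := fun h a b => Subtype.ext (A.mul_op_smul h a.1 b.1)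
    op_smul_mul := fun h a b => Subtype.ext (A.op_smul_mul h a.1 b.1)
    op_smul_of_central := fun hc h a => Subtype.ext (A.op_smul_of_central hc h a.1) }

/-- The inclusion of a subalgebra. -/
def incl : Hom S.toHAlg A where
  toFun a := a.1
  map_add' _ _ := rfl
  map_mul' _ _ := rfl
  map_smul' _ _ := rfl
  map_op_smul' _ _ := rfl

theorem incl_injective : Function.Injective S.incl := Subtype.val_injective

theorem incl_mem (a : S.toHAlg) : S.incl a ∈ S.carrier := a.2

/-- A homomorphism with values in a subalgebra. -/
def codRestrict {B : HAlg H c} (f : Hom B A) (h : ∀ b, f b ∈ S.carrier) : Hom B S.toHAlg where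
  toFun b := ⟨f b, h b⟩
  map_add' a b := Subtype.ext (map_add f a b)
  map_mul' a b := Subtype.ext (f.map_mul a b)
  map_smul' r b := Subtype.ext (f.map_smul r b)
  map_op_smul' r b := Subtype.ext (f.map_op_smul r b)

@[simp] theorem incl_codRestrict {B : HAlg H c} (f : Hom B A) (h : ∀ b, f b ∈ S.carrier) (b : B) :
    S.incl (S.codRestrict f h b) = f b := rfl

/-- The preimage of a subalgebra. -/
def comap {B : HAlg H c} (f : Hom B A) : Sub B where
  carrier := {b | f b ∈ S.carrier}
  zero_mem' := by
    change f 0 ∈ S.carrier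
    rw [map_zero f]; exact S.zero_mem'
  add_mem' := fun {a b} ha hb => by
    change f (a + b) ∈ S.carrier
    rw [map_add f]; exact S.add_mem' ha hb
  neg_mem' := fun {a} ha => by
    change f (-a) ∈ S.carrier
    rw [map_neg f]; exact S.neg_mem' ha
  mul_mem' := fun {a b} ha hb => by
    change f (a * b) ∈ S.carrier
    rw [f.map_mul]; exact S.mul_mem' ha hb
  smul_mem h a ha := by
    change f (h • a) ∈ S.carrier
    rw [f.map_smul]; exact S.smul_mem h _ ha
  op_smul_mem h a ha := by
    change f (op h • a) ∈ S.carrier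
    rw [f.map_op_smul]; exact S.op_smul_mem h _ ha

/-- Two-sided ideals. -/
def IsIdeal : Prop := ∀ a x : A, x ∈ S.carrier → a * x ∈ S.carrier ∧ x * a ∈ S.carrier

/-- The quotient of an `H`-algebra by a two-sided ideal. -/
def quotient (hS : S.IsIdeal) : HAlg H c :=
  let I : AddSubgroup A := S.toNonUnitalSubring.toAddSubgroup
  letI : Mul (A ⧸ I) := ⟨Quotient.map₂ (· * ·) (by
    intro a a' h b b' h'
    replace h : -a + a' ∈ I := QuotientAddGroup.leftRel_apply.mp h
    replace h' : -b + b' ∈ I := QuotientAddGroup.leftRel_apply.mp h'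
    refine QuotientAddGroup.leftRel_apply.mpr ?_
    change -(a * b) + a' * b' ∈ I
    have e : -(a * b) + a' * b' = (-a + a') * b + a' * (-b + b') := by noncomm_ring
    rw [e]
    exact I.add_mem (hS _ _ h).2 (hS _ _ h').1)⟩
  letI : NonUnitalRing (A ⧸ I) :=
    { (inferInstance : AddCommGroup (A ⧸ I)), (inferInstance : Mul (A ⧸ I)) with
      left_distrib := by
        rintro ⟨a⟩ ⟨b⟩ ⟨d⟩
        exact congrArg (QuotientAddGroup.mk (s := I)) (mul_add a b d)
      right_distrib := by
        rintro ⟨a⟩ ⟨b⟩ ⟨d⟩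
        exact congrArg (QuotientAddGroup.mk (s := I)) (add_mul a b d)
      zero_mul := by
        rintro ⟨a⟩
        exact congrArg (QuotientAddGroup.mk (s := I)) (zero_mul a)
      mul_zero := by
        rintro ⟨a⟩
        exact congrArg (QuotientAddGroup.mk (s := I)) (mul_zero a)
      mul_assoc := by
        rintro ⟨a⟩ ⟨b⟩ ⟨d⟩
        exact congrArg (QuotientAddGroup.mk (s := I)) (mul_assoc a b d) }
  letI : SMul H (A ⧸ I) := ⟨fun h => Quotient.map (h • ·) (by
    intro a a' ha
    replace ha : -a + a' ∈ I := QuotientAddGroup.leftRel_apply.mp ha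
    refine QuotientAddGroup.leftRel_apply.mpr ?_
    change -(h • a) + h • a' ∈ I
    rw [← smul_neg, ← smul_add]
    exact S.smul_mem h _ ha)⟩
  letI : SMul Hᵐᵒᵖ (A ⧸ I) := ⟨fun h => Quotient.map (h • ·) (by
    intro a a' ha
    replace ha : -a + a' ∈ I := QuotientAddGroup.leftRel_apply.mp ha
    refine QuotientAddGroup.leftRel_apply.mpr ?_
    change -(h • a) + h • a' ∈ I
    rw [← smul_neg, ← smul_add]
    exact S.op_smul_mem h.unop _ ha)⟩
  letI : Module H (A ⧸ I) := Function.Surjective.module H (QuotientAddGroup.mk' I)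
    (QuotientAddGroup.mk'_surjective I) (fun _ _ => rfl)
  letI : Module Hᵐᵒᵖ (A ⧸ I) := Function.Surjective.module Hᵐᵒᵖ (QuotientAddGroup.mk' I)
    (QuotientAddGroup.mk'_surjective I) (fun _ _ => rfl)
  { carrier := A ⧸ I
    smulComm := ⟨by
      rintro h k ⟨a⟩
      exact congrArg (QuotientAddGroup.mk (s := I)) (smul_comm h k a)⟩
    smul_mul := by
      rintro h ⟨a⟩ ⟨b⟩
      exact congrArg (QuotientAddGroup.mk (s := I)) (A.smul_mul h a b)
    mul_op_smul := by
      rintro h ⟨a⟩ ⟨b⟩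
      exact congrArg (QuotientAddGroup.mk (s := I)) (A.mul_op_smul h a b)
    op_smul_mul := by
      rintro h ⟨a⟩ ⟨b⟩
      exact congrArg (QuotientAddGroup.mk (s := I)) (A.op_smul_mul h a b)
    op_smul_of_central := by
      rintro hc h ⟨a⟩
      exact congrArg (QuotientAddGroup.mk (s := I)) (A.op_smul_of_central hc h a) }

/-- The quotient map. -/
def mkQ (hS : S.IsIdeal) : Hom A (S.quotient hS) where
  toFun a := QuotientAddGroup.mk (s := S.toNonUnitalSubring.toAddSubgroup) a
  map_add' _ _ := rfl
  map_mul' _ _ := rfl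
  map_smul' _ _ := rfl
  map_op_smul' _ _ := rfl

end Sub

/-- The kernel of a homomorphism. -/
def ker {A B : HAlg H c} (f : Hom A B) : Sub A where
  carrier := {a | f a = 0}
  zero_mem' := map_zero f
  add_mem' := fun {a b} ha hb => by
    change f (a + b) = 0
    rw [map_add f, show f a = 0 from ha, show f b = 0 from hb, add_zero]
  neg_mem' := fun {a} ha => by
    change f (-a) = 0
    rw [map_neg f, show f a = 0 from ha, neg_zero]
  mul_mem' := fun {a b} ha hb => by
    change f (a * b) = 0
    rw [f.map_mul, show f a = 0 from ha, zero_mul]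
  smul_mem h a ha := by
    change f (h • a) = 0
    rw [f.map_smul, show f a = 0 from ha, smul_zero]
  op_smul_mem h a ha := by
    change f (op h • a) = 0
    rw [f.map_op_smul, show f a = 0 from ha, smul_zero]

end HAlg

/-! ### The underlying category and the universal extension -/

/-- The possible choices of the underlying category: sets, (central) `H`-bimodules, or abelian
groups.  A morphism of central bimodules is the same as a morphism of bimodules. -/
inductive Underlying : Type
  | sets
  | bimodules
  | abGroups

open HAlg

variable {H : Type u} [Ring H] {c : AlgClass H}

/-- `U.IsHom f`: the map `f` is a morphism in the underlying category `U`. -/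
def Underlying.IsHom (U : Underlying) {A B : HAlg H c} (f : A → B) : Prop :=
  match U with
  | .sets => True
  | .bimodules => (∀ a b, f (a + b) = f a + f b) ∧ (∀ (h : H) a, f (h • a) = h • f a) ∧
      ∀ (h : H) a, f (op h • a) = op h • f a
  | .abGroups => ∀ a b, f (a + b) = f a + f b

theorem Underlying.isHom_hom (U : Underlying) {A B : HAlg H c} (f : Hom A B) : U.IsHom f := by
  cases U
  · trivial
  · exact ⟨map_add f, f.map_smul, f.map_op_smul⟩
  · exact map_add f

theorem Underlying.IsHom.comp {U : Underlying} {A B C : HAlg H c} {g : B → C} {f : A → B}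
    (hg : U.IsHom g) (hf : U.IsHom f) : U.IsHom (fun a => g (f a)) := by
  cases U
  · trivial
  · obtain ⟨g1, g2, g3⟩ := hg
    obtain ⟨f1, f2, f3⟩ := hf
    exact ⟨fun a b => (congrArg g (f1 a b)).trans (g1 _ _),
      fun h a => (congrArg g (f2 h a)).trans (g2 _ _),
      fun h a => (congrArg g (f3 h a)).trans (g3 _ _)⟩
  · intro a b
    change g (f (a + b)) = _
    rw [show f (a + b) = f a + f b from hf a b]
    exact hg _ _

/-- A homomorphism is an `F`-split surjection if it has a section in the underlying category. -/
def IsFSplit (U : Underlying) {A B : HAlg H c} (f : Hom A B) : Prop :=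
  ∃ s : B → A, U.IsHom s ∧ ∀ b, f (s b) = b

namespace FreeAlg

/-- Formal expressions in generators from `A`. -/
inductive Pre (H A : Type u) : Type u
  | of (a : A)
  | zero
  | add (x y : Pre H A)
  | neg (x : Pre H A)
  | mul (x y : Pre H A)
  | lsmul (h : H) (x : Pre H A)
  | rsmul (h : H) (x : Pre H A)

open Pre in
/-- The congruence generated by the laws of an `H`-algebra (central if required) and by the
condition that the inclusion `a ↦ of a` of the generators be a morphism of the underlying
category. -/
inductive Rel (U : Underlying) (A : HAlg H c) : Pre H A → Pre H A → Prop
  | refl (x) : Rel U A x x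
  | symm {x y} : Rel U A x y → Rel U A y x
  | trans {x y z} : Rel U A x y → Rel U A y z → Rel U A x z
  | add_congr {x x' y y'} : Rel U A x x' → Rel U A y y' → Rel U A (add x y) (add x' y')
  | neg_congr {x x'} : Rel U A x x' → Rel U A (neg x) (neg x')
  | mul_congr {x x' y y'} : Rel U A x x' → Rel U A y y' → Rel U A (mul x y) (mul x' y')
  | lsmul_congr (h : H) {x x'} : Rel U A x x' → Rel U A (lsmul h x) (lsmul h x')
  | rsmul_congr (h : H) {x x'} : Rel U A x x' → Rel U A (rsmul h x) (rsmul h x')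
  | add_assoc (x y z) : Rel U A (add (add x y) z) (add x (add y z))
  | add_comm (x y) : Rel U A (add x y) (add y x)
  | zero_add (x) : Rel U A (add zero x) x
  | neg_add (x) : Rel U A (add (neg x) x) zero
  | mul_assoc (x y z) : Rel U A (mul (mul x y) z) (mul x (mul y z))
  | mul_add (x y z) : Rel U A (mul x (add y z)) (add (mul x y) (mul x z))
  | add_mul (x y z) : Rel U A (mul (add x y) z) (add (mul x z) (mul y z))
  | one_lsmul (x) : Rel U A (lsmul 1 x) x
  | mul_lsmul (h k : H) (x) : Rel U A (lsmul (h * k) x) (lsmul h (lsmul k x))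
  | add_lsmul (h k : H) (x) : Rel U A (lsmul (h + k) x) (add (lsmul h x) (lsmul k x))
  | lsmul_add (h : H) (x y) : Rel U A (lsmul h (add x y)) (add (lsmul h x) (lsmul h y))
  | one_rsmul (x) : Rel U A (rsmul 1 x) x
  | mul_rsmul (h k : H) (x) : Rel U A (rsmul (h * k) x) (rsmul k (rsmul h x))
  | add_rsmul (h k : H) (x) : Rel U A (rsmul (h + k) x) (add (rsmul h x) (rsmul k x))
  | rsmul_add (h : H) (x y) : Rel U A (rsmul h (add x y)) (add (rsmul h x) (rsmul h y))
  | smul_comm (h k : H) (x) : Rel U A (lsmul h (rsmul k x)) (rsmul k (lsmul h x))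
  | zero_mul (x) : Rel U A (mul zero x) zero
  | mul_zero (x) : Rel U A (mul x zero) zero
  | lsmul_zero (h : H) : Rel U A (lsmul h zero) zero
  | zero_lsmul (x) : Rel U A (lsmul 0 x) zero
  | rsmul_zero (h : H) : Rel U A (rsmul h zero) zero
  | zero_rsmul (x) : Rel U A (rsmul 0 x) zero
  | lsmul_mul (h : H) (x y) : Rel U A (mul (lsmul h x) y) (lsmul h (mul x y))
  | mul_rsmul' (h : H) (x y) : Rel U A (mul x (rsmul h y)) (rsmul h (mul x y))
  | rsmul_mul (h : H) (x y) : Rel U A (mul (rsmul h x) y) (mul x (lsmul h y))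
  | central (hc : c.IsCentral) (h : H) (x) : Rel U A (rsmul h x) (lsmul h x)
  | of_add (hU : U ≠ .sets) (a b : A) : Rel U A (of (a + b)) (add (of a) (of b))
  | of_lsmul (hU : U = .bimodules) (h : H) (a : A) : Rel U A (of (h • a)) (lsmul h (of a))
  | of_rsmul (hU : U = .bimodules) (h : H) (a : A) : Rel U A (of (op h • a)) (rsmul h (of a))

/-- Evaluation of formal expressions in an `H`-algebra. -/
def Pre.eval {A B : HAlg H c} (f : A → B) : Pre H A → B
  | .of a => f a
  | .zero => 0
  | .add x y => x.eval f + y.eval f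
  | .neg x => - x.eval f
  | .mul x y => x.eval f * y.eval f
  | .lsmul h x => h • x.eval f
  | .rsmul h x => op h • x.eval f

theorem eval_eq {U : Underlying} {A B : HAlg H c} {f : A → B} (hf : U.IsHom f) {x y : Pre H A}
    (h : Rel U A x y) : x.eval f = y.eval f := by
  induction h with
  | refl => rfl
  | symm _ ih => exact ih.symm
  | trans _ _ ih ih' => exact ih.trans ih'
  | add_congr _ _ ih ih' => exact congrArg₂ (· + ·) ih ih'
  | neg_congr _ ih => exact congrArg (- ·) ih
  | mul_congr _ _ ih ih' => exact congrArg₂ (· * ·) ih ih'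
  | lsmul_congr h _ ih => exact congrArg (h • ·) ih
  | rsmul_congr h _ ih => exact congrArg (op h • ·) ih
  | add_assoc x y z => exact _root_.add_assoc _ _ _
  | add_comm x y => exact _root_.add_comm _ _
  | zero_add x => exact _root_.zero_add _
  | neg_add x => exact neg_add_cancel _
  | mul_assoc x y z => exact _root_.mul_assoc _ _ _
  | mul_add x y z => exact _root_.mul_add _ _ _
  | add_mul x y z => exact _root_.add_mul _ _ _
  | one_lsmul x => exact one_smul _ _
  | mul_lsmul h k x => exact mul_smul _ _ _
  | add_lsmul h k x => exact add_smul _ _ _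
  | lsmul_add h x y => exact smul_add _ _ _
  | one_rsmul x => exact one_smul _ _
  | mul_rsmul h k x => exact mul_smul (op k) (op h) _
  | add_rsmul h k x => exact add_smul (op h) (op k) _
  | rsmul_add h x y => exact smul_add _ _ _
  | smul_comm h k x => exact SMulCommClass.smul_comm _ _ _
  | zero_mul x => exact MulZeroClass.zero_mul _
  | mul_zero x => exact MulZeroClass.mul_zero _
  | lsmul_zero h => exact smul_zero _
  | zero_lsmul x => exact zero_smul _ _
  | rsmul_zero h => exact smul_zero _
  | zero_rsmul x => exact zero_smul Hᵐᵒᵖ _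
  | lsmul_mul h x y => exact B.smul_mul _ _ _
  | mul_rsmul' h x y => exact B.mul_op_smul _ _ _
  | rsmul_mul h x y => exact B.op_smul_mul _ _ _
  | central hc h x => exact B.op_smul_of_central hc _ _
  | of_add hU a b =>
    cases U
    · exact absurd rfl hU
    · exact hf.1 a b
    · exact hf a b
  | of_lsmul hU h a => subst hU; exact hf.2.1 h a
  | of_rsmul hU h a => subst hU; exact hf.2.2 h a

end FreeAlg

open FreeAlg in
/-- `T(A)`: the free `H`-algebra on the object of the underlying category given by `A`. -/
def T (U : Underlying) (A : HAlg H c) : HAlg H c :=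
  letI : Zero (Quot (Rel U A)) := ⟨Quot.mk _ .zero⟩
  letI : Add (Quot (Rel U A)) := ⟨Quot.map₂ .add (fun _ _ _ h => .add_congr (.refl _) h)
    (fun _ _ _ h => .add_congr h (.refl _))⟩
  letI : Neg (Quot (Rel U A)) := ⟨Quot.map .neg (fun _ _ h => .neg_congr h)⟩
  letI : Mul (Quot (Rel U A)) := ⟨Quot.map₂ .mul (fun _ _ _ h => .mul_congr (.refl _) h)
    (fun _ _ _ h => .mul_congr h (.refl _))⟩
  letI : NonUnitalRing (Quot (Rel U A)) :=
    { nsmul := nsmulRec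
      zsmul := zsmulRec
      add_assoc := by rintro ⟨x⟩ ⟨y⟩ ⟨z⟩; exact Quot.sound (.add_assoc x y z)
      add_comm := by rintro ⟨x⟩ ⟨y⟩; exact Quot.sound (.add_comm x y)
      zero_add := by rintro ⟨x⟩; exact Quot.sound (.zero_add x)
      add_zero := by rintro ⟨x⟩; exact Quot.sound (.trans (.add_comm x _) (.zero_add x))
      neg_add_cancel := by rintro ⟨x⟩; exact Quot.sound (.neg_add x)
      mul_assoc := by rintro ⟨x⟩ ⟨y⟩ ⟨z⟩; exact Quot.sound (.mul_assoc x y z)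
      left_distrib := by rintro ⟨x⟩ ⟨y⟩ ⟨z⟩; exact Quot.sound (.mul_add x y z)
      right_distrib := by rintro ⟨x⟩ ⟨y⟩ ⟨z⟩; exact Quot.sound (.add_mul x y z)
      zero_mul := by rintro ⟨x⟩; exact Quot.sound (.zero_mul x)
      mul_zero := by rintro ⟨x⟩; exact Quot.sound (.mul_zero x) }
  letI : Module H (Quot (Rel U A)) :=
    { smul := fun h => Quot.map (.lsmul h) (fun _ _ r => .lsmul_congr h r)
      one_smul := by rintro ⟨x⟩; exact Quot.sound (.one_lsmul x)
      mul_smul := by rintro h k ⟨x⟩; exact Quot.sound (.mul_lsmul h k x)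
      smul_zero := fun h => Quot.sound (.lsmul_zero h)
      zero_smul := by rintro ⟨x⟩; exact Quot.sound (.zero_lsmul x)
      smul_add := by rintro h ⟨x⟩ ⟨y⟩; exact Quot.sound (.lsmul_add h x y)
      add_smul := by rintro h k ⟨x⟩; exact Quot.sound (.add_lsmul h k x) }
  letI : Module Hᵐᵒᵖ (Quot (Rel U A)) :=
    { smul := fun h => Quot.map (.rsmul h.unop) (fun _ _ r => .rsmul_congr h.unop r)
      one_smul := by rintro ⟨x⟩; exact Quot.sound (.one_rsmul x)
      mul_smul := by rintro h k ⟨x⟩; exact Quot.sound (.mul_rsmul k.unop h.unop x)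
      smul_zero := fun h => Quot.sound (.rsmul_zero h.unop)
      zero_smul := by rintro ⟨x⟩; exact Quot.sound (.zero_rsmul x)
      smul_add := by rintro h ⟨x⟩ ⟨y⟩; exact Quot.sound (.rsmul_add h.unop x y)
      add_smul := by rintro h k ⟨x⟩; exact Quot.sound (.add_rsmul h.unop k.unop x) }
  { carrier := Quot (Rel U A)
    smulComm := ⟨by rintro h k ⟨x⟩; exact Quot.sound (.smul_comm h k.unop x)⟩
    smul_mul := by rintro h ⟨x⟩ ⟨y⟩; exact Quot.sound (.lsmul_mul h x y)
    mul_op_smul := by rintro h ⟨x⟩ ⟨y⟩; exact Quot.sound (.mul_rsmul' h x y)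
    op_smul_mul := by rintro h ⟨x⟩ ⟨y⟩; exact Quot.sound (.rsmul_mul h x y)
    op_smul_of_central := by rintro hc h ⟨x⟩; exact Quot.sound (.central hc h x) }

namespace T

variable {U : Underlying} {A B C : HAlg H c}

/-- The canonical morphism `A → T(A)` of the underlying category. -/
def of (U : Underlying) (A : HAlg H c) (a : A) : T U A := Quot.mk _ (.of a)

theorem isHom_of : U.IsHom (of U A) := by
  cases U
  · trivial
  · exact ⟨fun a b => Quot.sound (.of_add (by simp) a b),
      fun h a => Quot.sound (.of_lsmul rfl h a), fun h a => Quot.sound (.of_rsmul rfl h a)⟩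
  · exact fun a b => Quot.sound (.of_add (by simp) a b)

/-- The homomorphism `T(A) → B` that extends a morphism `A → B` of the underlying category. -/
def lift (f : A → B) (hf : U.IsHom f) : Hom (T U A) B where
  toFun := Quot.lift (fun x => x.eval f) (fun _ _ h => FreeAlg.eval_eq hf h)
  map_add' := by rintro ⟨x⟩ ⟨y⟩; rfl
  map_mul' := by rintro ⟨x⟩ ⟨y⟩; rfl
  map_smul' := by rintro h ⟨x⟩; rfl
  map_op_smul' := by rintro h ⟨x⟩; rfl

@[simp] theorem lift_of (f : A → B) (hf : U.IsHom f) (a : A) : lift f hf (of U A a) = f a := rfl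

theorem hom_ext {f g : Hom (T U A) B} (h : ∀ a, f (of U A a) = g (of U A a)) : f = g := by
  have key : ∀ x : FreeAlg.Pre H A,
      f (Quot.mk (FreeAlg.Rel U A) x) = g (Quot.mk (FreeAlg.Rel U A) x) := by
    intro x
    let q : FreeAlg.Pre H A → T U A := Quot.mk (FreeAlg.Rel U A)
    induction x with
    | of a => exact h a
    | zero => exact (map_zero f).trans (map_zero g).symm
    | add x y hx hy =>
      exact (map_add f (q x) (q y)).trans
        ((congrArg₂ (· + ·) hx hy).trans (map_add g (q x) (q y)).symm)
    | neg x hx => exact (map_neg f (q x)).trans ((congrArg (- ·) hx).trans (map_neg g (q x)).symm)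
    | mul x y hx hy =>
      exact (f.map_mul (q x) (q y)).trans
        ((congrArg₂ (· * ·) hx hy).trans (g.map_mul (q x) (q y)).symm)
    | lsmul r x hx =>
      exact (f.map_smul r (q x)).trans ((congrArg (r • ·) hx).trans (g.map_smul r (q x)).symm)
    | rsmul r x hx =>
      exact (f.map_op_smul r (q x)).trans
        ((congrArg (op r • ·) hx).trans (g.map_op_smul r (q x)).symm)
  refine Hom.ext' ?_
  rintro ⟨x⟩
  exact key x

/-- The functor `T` on homomorphisms. -/
def map (U : Underlying) (f : Hom A B) : Hom (T U A) (T U B) :=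
  lift (fun a => of U B (f a)) (isHom_of.comp (U.isHom_hom f))

/-- The counit `T(A) → A`. -/
def counit (U : Underlying) (A : HAlg H c) : Hom (T U A) A :=
  lift (fun a => a) (U.isHom_hom (Hom.id A))

@[simp] theorem map_of (f : Hom A B) (a : A) : map U f (of U A a) = of U B (f a) := rfl

@[simp] theorem counit_of (a : A) : counit U A (of U A a) = a := rfl

theorem counit_map (f : Hom A B) (x : T U A) : counit U B (map U f x) = f (counit U A x) := by
  have : (counit U B).comp (map U f) = f.comp (counit U A) := hom_ext fun a => rfl
  exact congrArg (fun g => g x) this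

theorem map_comp (g : Hom B C) (f : Hom A B) : map U (g.comp f) = (map U g).comp (map U f) :=
  hom_ext fun _ => rfl

end T

/-- `J(A)`, the kernel of the counit `T(A) → A`. -/
def J (U : Underlying) (A : HAlg H c) : HAlg H c := (ker (T.counit U A)).toHAlg

namespace J

variable {U : Underlying} {A B C : HAlg H c}

/-- The inclusion of `J(A)` in `T(A)`. -/
def incl (U : Underlying) (A : HAlg H c) : Hom (J U A) (T U A) := (ker (T.counit U A)).incl

theorem counit_incl (x : J U A) : T.counit U A (incl U A x) = 0 := x.2

theorem incl_injective : Function.Injective (incl U A) := Subtype.val_injective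

/-- The functor `J` on homomorphisms. -/
def map (U : Underlying) (f : Hom A B) : Hom (J U A) (J U B) :=
  (ker (T.counit U B)).codRestrict ((T.map U f).comp (incl U A)) fun x => by
    change T.counit U B (T.map U f (incl U A x)) = 0
    rw [T.counit_map, counit_incl, map_zero f]

theorem incl_map (f : Hom A B) (x : J U A) : incl U B (map U f x) = T.map U f (incl U A x) := rfl

theorem map_comp (g : Hom B C) (f : Hom A B) : map U (g.comp f) = (map U g).comp (map U f) := by
  refine Hom.ext' fun x => incl_injective ?_
  simp only [incl_map, T.map_comp, Hom.comp_apply]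

/-- The iterates `Jⁿ(A)`. -/
def iter (U : Underlying) : ℕ → HAlg H c → HAlg H c
  | 0, A => A
  | n + 1, A => J U (iter U n A)

/-- The functor `Jⁿ` on homomorphisms. -/
def iterMap (U : Underlying) : (n : ℕ) → {A B : HAlg H c} → Hom A B →
    Hom (iter U n A) (iter U n B)
  | 0, _, _, f => f
  | n + 1, _, _, f => map U (iterMap U n f)

end J

/-- An `F`-split extension `K → E → C` of `H`-algebras with a chosen section in the underlying
category that preserves zero. -/
structure SplitExt (U : Underlying) (K E C : HAlg H c) where
  i : Hom K E
  p : Hom E C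
  s : C → E
  injective : Function.Injective i
  p_i : ∀ k, p (i k) = 0
  exact : ∀ e, p e = 0 → ∃ k, i k = e
  isHom : U.IsHom s
  s_zero : s 0 = 0
  p_s : ∀ x, p (s x) = x

namespace SplitExt

variable {U : Underlying} {K E C : HAlg H c} (X : SplitExt U K E C)

/-- The homomorphism `T(C) → E` over `C` given by the section. -/
def liftT : Hom (T U C) E := T.lift X.s X.isHom

theorem p_liftT (x : T U C) : X.p (X.liftT x) = T.counit U C x := by
  have : X.p.comp X.liftT = T.counit U C := T.hom_ext fun a => X.p_s a
  exact congrArg (fun g => g x) this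

/-- The classifying map `J(C) → K` of a split extension: the restriction to kernels of
the homomorphism `T(C) → E` given by the section. -/
noncomputable def classify : Hom (J U C) K :=
  Hom.factor X.i X.injective (X.liftT.comp (J.incl U C)) fun x =>
    X.exact _ (by rw [Hom.comp_apply, p_liftT, J.counit_incl])

theorem i_classify (x : J U C) : X.i (X.classify x) = X.liftT (J.incl U C x) :=
  Hom.factor_spec _ _ _ _ x

end SplitExt

/-! ### Tensor products with commutative rings, homotopies, and simplicial powers -/

namespace HAlg

variable {A B C : HAlg H c} {R S : Type} [CommRing R] [CommRing S]

theorem tensor_zero_mul (A : HAlg H c) (y : A ⊗[ℤ] R) : (0 : A ⊗[ℤ] R) * y = 0 :=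
  (Algebra.TensorProduct.instNonUnitalRing (R := ℤ) (A := A) (B := R)).zero_mul y

theorem tensor_mul_zero (A : HAlg H c) (y : A ⊗[ℤ] R) : y * (0 : A ⊗[ℤ] R) = 0 :=
  (Algebra.TensorProduct.instNonUnitalRing (R := ℤ) (A := A) (B := R)).mul_zero y

/-- The `H`-algebra `A ⊗ R`, the tensor product being taken over `ℤ`. -/
noncomputable def tensor (A : HAlg H c) (R : Type) [CommRing R] : HAlg H c where
  carrier := A ⊗[ℤ] R
  smul_mul h x y := by
    induction x with
    | zero => rw [smul_zero, tensor_zero_mul, smul_zero]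
    | add x x' hx hx' => rw [smul_add, add_mul, hx, hx', add_mul, smul_add]
    | tmul a r =>
      induction y with
      | zero => rw [tensor_mul_zero, tensor_mul_zero, smul_zero]
      | add y y' hy hy' => rw [mul_add, hy, hy', mul_add, smul_add]
      | tmul b r' =>
        rw [TensorProduct.smul_tmul', Algebra.TensorProduct.tmul_mul_tmul,
          Algebra.TensorProduct.tmul_mul_tmul, TensorProduct.smul_tmul', A.smul_mul]
  mul_op_smul h x y := by
    induction x with
    | zero => rw [tensor_zero_mul, tensor_zero_mul, smul_zero]
    | add x x' hx hx' => rw [add_mul, hx, hx', add_mul, smul_add]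
    | tmul a r =>
      induction y with
      | zero => rw [smul_zero, tensor_mul_zero, smul_zero]
      | add y y' hy hy' => rw [smul_add, mul_add, hy, hy', mul_add, smul_add]
      | tmul b r' =>
        rw [TensorProduct.smul_tmul', Algebra.TensorProduct.tmul_mul_tmul,
          Algebra.TensorProduct.tmul_mul_tmul, TensorProduct.smul_tmul', A.mul_op_smul]
  op_smul_mul h x y := by
    induction x with
    | zero => rw [smul_zero, tensor_zero_mul, tensor_zero_mul]
    | add x x' hx hx' => rw [smul_add, add_mul, hx, hx', add_mul]
    | tmul a r =>
      induction y with
      | zero => rw [smul_zero, tensor_mul_zero, tensor_mul_zero]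
      | add y y' hy hy' => rw [smul_add, mul_add, hy, hy', mul_add]
      | tmul b r' =>
        rw [TensorProduct.smul_tmul', TensorProduct.smul_tmul',
          Algebra.TensorProduct.tmul_mul_tmul, Algebra.TensorProduct.tmul_mul_tmul,
          A.op_smul_mul]
  op_smul_of_central hc h x := by
    induction x with
    | zero => rw [smul_zero, smul_zero]
    | add x x' hx hx' => rw [smul_add, smul_add, hx, hx']
    | tmul a r =>
      rw [TensorProduct.smul_tmul', TensorProduct.smul_tmul', A.op_smul_of_central hc]

/-- The pure tensor `a ⊗ r`. -/
noncomputable def tmul (a : A) (r : R) : A.tensor R := a ⊗ₜ[ℤ] r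

theorem tensor_induction {P : A.tensor R → Prop} (h0 : P 0) (h : ∀ a r, P (tmul a r))
    (hadd : ∀ x y, P x → P y → P (x + y)) (x : A.tensor R) : P x :=
  TensorProduct.induction_on (motive := P) x h0 h hadd

theorem tensor_hom_ext {f g : Hom (A.tensor R) B} (h : ∀ a r, f (tmul a r) = g (tmul a r)) :
    f = g := by
  refine Hom.ext' fun x => ?_
  induction x using tensor_induction with
  | h0 => rw [map_zero f, map_zero g]
  | h a r => exact h a r
  | hadd x y hx hy => rw [map_add f, map_add g, hx, hy]

theorem tmul_mul_tmul (a b : A) (r s : R) : tmul a r * tmul b s = tmul (a * b) (r * s) :=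
  Algebra.TensorProduct.tmul_mul_tmul a b r s

theorem smul_tmul (h : H) (a : A) (r : R) : h • tmul a r = tmul (h • a) r :=
  TensorProduct.smul_tmul' h a r

theorem op_smul_tmul (h : H) (a : A) (r : R) : op h • tmul a r = tmul (op h • a) r :=
  TensorProduct.smul_tmul' (op h) a r

/-- An additive map on `A ⊗ R` that is multiplicative and bilinear on pure tensors is a
homomorphism. -/
noncomputable def Hom.ofTensor (F : A.tensor R →+ B)
    (hmul : ∀ a r b s, F (tmul a r * tmul b s) = F (tmul a r) * F (tmul b s))
    (hsmul : ∀ (h : H) a r, F (h • tmul a r) = h • F (tmul a r))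
    (hop : ∀ (h : H) a r, F (op h • tmul a r) = op h • F (tmul a r)) : Hom (A.tensor R) B where
  toFun := F
  map_add' := F.map_add
  map_mul' x y := by
    induction x using tensor_induction with
    | h0 => rw [zero_mul, F.map_zero, zero_mul]
    | hadd x x' hx hx' => rw [add_mul, F.map_add, hx, hx', F.map_add, add_mul]
    | h a r =>
      induction y using tensor_induction with
      | h0 => rw [mul_zero, F.map_zero, mul_zero]
      | hadd y y' hy hy' => rw [mul_add, F.map_add, hy, hy', F.map_add, mul_add]
      | h b s => exact hmul a r b s
  map_smul' h x := by
    induction x using tensor_induction with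
    | h0 => rw [smul_zero, F.map_zero, smul_zero]
    | hadd x x' hx hx' => rw [smul_add, F.map_add, hx, hx', F.map_add, smul_add]
    | h a r => exact hsmul h a r
  map_op_smul' h x := by
    induction x using tensor_induction with
    | h0 => rw [smul_zero, F.map_zero, smul_zero]
    | hadd x x' hx hx' => rw [smul_add, F.map_add, hx, hx', F.map_add, smul_add]
    | h a r => exact hop h a r

/-- `A ⊗ R → B ⊗ S` induced by `A → B` and `R → S`. -/
noncomputable def Hom.tensor (f : Hom A B) (φ : R →+* S) : Hom (A.tensor R) (B.tensor S) :=
  Hom.ofTensor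
    (TensorProduct.map (AddMonoidHomClass.toAddMonoidHom f).toIntLinearMap
      φ.toAddMonoidHom.toIntLinearMap).toAddMonoidHom
    (fun a r b s => by
      have key (a : A) (r : R) : (TensorProduct.map
          (AddMonoidHomClass.toAddMonoidHom f).toIntLinearMap
          φ.toAddMonoidHom.toIntLinearMap).toAddMonoidHom (tmul a r) = tmul (f a) (φ r) := rfl
      rw [tmul_mul_tmul]
      refine (key _ _).trans ?_
      rw [f.map_mul, _root_.map_mul φ, ← tmul_mul_tmul]
      rfl)
    (fun h a r => by
      rw [smul_tmul]
      refine Eq.trans (b := tmul (f (h • a)) (φ r)) rfl ?_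
      rw [f.map_smul, ← smul_tmul]
      rfl)
    (fun h a r => by
      rw [op_smul_tmul]
      refine Eq.trans (b := tmul (f (op h • a)) (φ r)) rfl ?_
      rw [f.map_op_smul, ← op_smul_tmul]
      rfl)

@[simp] theorem Hom.tensor_tmul (f : Hom A B) (φ : R →+* S) (a : A) (r : R) :
    f.tensor φ (tmul a r) = tmul (f a) (φ r) := rfl

theorem Hom.tensor_comp {R' : Type} [CommRing R'] (g : Hom B C) (f : Hom A B) (ψ : S →+* R')
    (φ : R →+* S) : (g.comp f).tensor (ψ.comp φ) = (g.tensor ψ).comp (f.tensor φ) :=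
  tensor_hom_ext fun _ _ => rfl

/-- `A ⊗ ℤ → A`. -/
noncomputable def tensorInt (A : HAlg H c) : Hom (A.tensor ℤ) A :=
  Hom.ofTensor (TensorProduct.rid ℤ A).toLinearMap.toAddMonoidHom
    (fun a r b s => by
      rw [tmul_mul_tmul]
      exact (smul_mul_smul_comm r a s b).symm)
    (fun h a r => by
      rw [smul_tmul]
      exact (smul_comm r h a))
    (fun h a r => by
      rw [op_smul_tmul]
      exact (smul_comm r (op h) a))

/-- `A ⊗ R → A` induced by a ring homomorphism `R → ℤ`. -/
noncomputable def tensorEval (A : HAlg H c) (φ : R →+* ℤ) : Hom (A.tensor R) A :=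
  A.tensorInt.comp ((Hom.id A).tensor φ)

@[simp] theorem tensorEval_tmul (φ : R →+* ℤ) (a : A) (r : R) :
    A.tensorEval φ (tmul a r) = φ r • a := rfl

/-- The polynomial algebra `A[t] = A ⊗ ℤ[t]`. -/
noncomputable abbrev poly (A : HAlg H c) : HAlg H c := A.tensor (Polynomial ℤ)

/-- The evaluation `A[t] → A` at an integer. -/
noncomputable def ev (A : HAlg H c) (k : ℤ) : Hom A.poly A :=
  A.tensorEval (Polynomial.evalRingHom k)

end HAlg

/-- Elementary homotopy of homomorphisms. -/
def ElemHomotopic {A B : HAlg H c} (f g : Hom A B) : Prop :=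
  ∃ h : Hom A B.poly, (B.ev 0).comp h = f ∧ (B.ev 1).comp h = g

/-- The coordinate ring `ℤ[t₀, …, tₙ] / (1 - ∑ tᵢ)` of the algebraic `n`-simplex. -/
def SimplexRing (n : ℕ) : Type :=
  MvPolynomial (Fin (n + 1)) ℤ ⧸ Ideal.span {(1 - ∑ i, MvPolynomial.X i :
    MvPolynomial (Fin (n + 1)) ℤ)}

namespace SimplexRing

noncomputable instance (n : ℕ) : CommRing (SimplexRing n) :=
  inferInstanceAs (CommRing (_ ⧸ Ideal.span _))

/-- The coordinate functions. -/
noncomputable def t {n : ℕ} (i : Fin (n + 1)) : SimplexRing n :=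
  Ideal.Quotient.mk _ (MvPolynomial.X i)

theorem sum_t (n : ℕ) : ∑ i : Fin (n + 1), (t i : SimplexRing n) = 1 := by
  have h : Ideal.Quotient.mk (Ideal.span {(1 - ∑ i, MvPolynomial.X i :
      MvPolynomial (Fin (n + 1)) ℤ)}) (1 - ∑ i, MvPolynomial.X i) = 0 :=
    Ideal.Quotient.eq_zero_iff_mem.mpr (Ideal.subset_span rfl)
  rw [map_sub, map_one, map_sum, sub_eq_zero] at h
  exact h.symm

/-- A family of elements with sum `1` defines a homomorphism on `SimplexRing n`. -/
noncomputable def lift {n : ℕ} {R : Type} [CommRing R] (x : Fin (n + 1) → R) (hx : ∑ i, x i = 1) :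
    SimplexRing n →+* R :=
  Ideal.Quotient.lift _ (MvPolynomial.aeval x : MvPolynomial (Fin (n + 1)) ℤ →ₐ[ℤ] R).toRingHom (by
    intro a ha
    refine (Ideal.span_le (I := RingHom.ker
      (MvPolynomial.aeval x : MvPolynomial (Fin (n + 1)) ℤ →ₐ[ℤ] R).toRingHom)).mpr ?_ ha
    rintro _ rfl
    simp [hx])

@[simp] theorem lift_t {n : ℕ} {R : Type} [CommRing R] (x : Fin (n + 1) → R) (hx : ∑ i, x i = 1)
    (i : Fin (n + 1)) : lift x hx (t i) = x i := MvPolynomial.aeval_X x i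

theorem hom_ext {n : ℕ} {R : Type} [CommRing R] {f g : SimplexRing n →+* R}
    (h : ∀ i, f (t i) = g (t i)) : f = g := by
  refine Ideal.Quotient.ringHom_ext (MvPolynomial.ringHom_ext (fun r => ?_) h)
  simp

open Classical in
/-- The map `ℤ^{Δⁿ} → ℤ^{Δᵐ}` induced by `θ : [m] → [n]`: it sends `tᵢ` to the sum of the
`tⱼ` with `θ j = i`. -/
noncomputable def map {m n : SimplexCategory} (θ : m ⟶ n) :
    SimplexRing n.len →+* SimplexRing m.len :=
  lift (fun i => ∑ j with θ.toOrderHom j = i, t j) (by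
    rw [← sum_t m.len]
    exact Finset.sum_fiberwise _ _ _)

open Classical in
theorem map_t {m n : SimplexCategory} (θ : m ⟶ n) (i : Fin (n.len + 1)) :
    map θ (t i) = ∑ j with θ.toOrderHom j = i, t j := lift_t _ _ _

theorem map_id (n : SimplexCategory) : map (𝟙 n) = RingHom.id _ :=
  hom_ext fun i => by
    classical
    rw [map_t]
    simp [Finset.filter_eq']

theorem map_comp {l m n : SimplexCategory} (θ : l ⟶ m) (η : m ⟶ n) :
    map (θ ≫ η) = (map θ).comp (map η) :=
  hom_ext fun i => by
    classical
    rw [map_t, RingHom.comp_apply, map_t, map_sum]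
    simp_rw [map_t]
    rw [Finset.sum_sigma']
    refine Finset.sum_bij' (fun j _ => ⟨θ.toOrderHom j, j⟩) (fun p _ => p.2) ?_ ?_ ?_ ?_ ?_
    · simp
    · rintro ⟨a, b⟩ h
      simp only [Finset.mem_sigma, Finset.mem_filter, Finset.mem_univ, true_and] at h ⊢
      change η.toOrderHom (θ.toOrderHom b) = i
      rw [h.2, h.1]
    · simp
    · rintro ⟨a, b⟩ h
      simp only [Finset.mem_sigma, Finset.mem_filter, Finset.mem_univ, true_and] at h
      simp [h.2]
    · simp

/-- The isomorphism of `ℤ^{Δ⁰}` with `ℤ`. -/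
noncomputable def aug : SimplexRing 0 →+* ℤ := lift (fun _ => 1) (by simp)

theorem intCast_aug (x : SimplexRing 0) : ((aug x : ℤ) : SimplexRing 0) = x := by
  have : (Int.castRingHom (SimplexRing 0)).comp aug = RingHom.id _ := hom_ext fun i => by
    have h := sum_t 0
    rw [Fin.sum_univ_one] at h
    have hi : i = 0 := Fin.fin_one_eq_zero i
    subst hi
    rw [RingHom.comp_apply, aug, lift_t, h]
    simp
  exact congrArg (fun g => g x) this

end SimplexRing

namespace HAlg

variable {A B C : HAlg H c}

/-- The simplicial set underlying the simplicial algebra `A^Δ`, `[n] ↦ A ⊗ ℤ^{Δⁿ}`. -/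
noncomputable def simplicial (A : HAlg H c) : SSet.{u} where
  obj n := A.tensor (SimplexRing n.unop.len)
  map θ := TypeCat.ofHom (fun x => (Hom.id A).tensor (SimplexRing.map θ.unop) x)
  map_id n := by
    ext x
    change (Hom.id A).tensor (SimplexRing.map (𝟙 _)) x = x
    rw [SimplexRing.map_id]
    have : (Hom.id A).tensor (RingHom.id (SimplexRing n.unop.len)) = Hom.id _ :=
      tensor_hom_ext fun _ _ => rfl
    rw [this]; rfl
  map_comp θ η := by
    ext x
    change (Hom.id A).tensor (SimplexRing.map (η.unop ≫ θ.unop)) x =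
      (Hom.id A).tensor (SimplexRing.map η.unop) ((Hom.id A).tensor (SimplexRing.map θ.unop) x)
    rw [SimplexRing.map_comp]
    exact congrArg (fun g : Hom _ _ => g x) (Hom.tensor_comp (Hom.id A) (Hom.id A)
      (SimplexRing.map η.unop) (SimplexRing.map θ.unop))

/-- The product of a family of `H`-algebras. -/
def pi {ι : Type u} (A : ι → HAlg H c) : HAlg H c where
  carrier := ∀ i, A i
  smul_mul h x y := funext fun i => (A i).smul_mul h (x i) (y i)
  mul_op_smul h x y := funext fun i => (A i).mul_op_smul h (x i) (y i)
  op_smul_mul h x y := funext fun i => (A i).op_smul_mul h (x i) (y i)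
  op_smul_of_central hc h x := funext fun i => (A i).op_smul_of_central hc h (x i)

/-- The compatible families in the product over all simplices `x ∈ Kₙ` of the algebras
`A ⊗ ℤ^{Δⁿ}`. -/
noncomputable def powSub (A : HAlg H c) (K : SSet.{u}) :
    Sub (pi fun s : (Σ n : SimplexCategoryᵒᵖ, K.obj n) => A.tensor (SimplexRing s.1.unop.len)) where
  carrier := {φ | ∀ (m n : SimplexCategoryᵒᵖ) (θ : m ⟶ n) (x : K.obj m),
    φ ⟨n, K.map θ x⟩ = (Hom.id A).tensor (SimplexRing.map θ.unop) (φ ⟨m, x⟩)}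
  zero_mem' _ _ θ _ := (map_zero ((Hom.id A).tensor (SimplexRing.map θ.unop))).symm
  add_mem' {_ _} hφ hψ m n θ x :=
    (congrArg₂ (· + ·) (hφ m n θ x) (hψ m n θ x)).trans
      (map_add ((Hom.id A).tensor (SimplexRing.map θ.unop)) _ _).symm
  neg_mem' {_} hφ m n θ x :=
    (congrArg (- ·) (hφ m n θ x)).trans
      (map_neg ((Hom.id A).tensor (SimplexRing.map θ.unop)) _).symm
  mul_mem' {_ _} hφ hψ m n θ x :=
    (congrArg₂ (· * ·) (hφ m n θ x) (hψ m n θ x)).trans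
      (((Hom.id A).tensor (SimplexRing.map θ.unop)).map_mul _ _).symm
  smul_mem h _ hφ m n θ x :=
    (congrArg (h • ·) (hφ m n θ x)).trans
      (((Hom.id A).tensor (SimplexRing.map θ.unop)).map_smul h _).symm
  op_smul_mem h _ hφ m n θ x :=
    (congrArg (op h • ·) (hφ m n θ x)).trans
      (((Hom.id A).tensor (SimplexRing.map θ.unop)).map_op_smul h _).symm

/-- The power `A^K`, the end `∫ₙ ∏_{x ∈ Kₙ} A ⊗ ℤ^{Δⁿ}`, for a simplicial set `K`. -/
noncomputable def pow (A : HAlg H c) (K : SSet.{u}) : HAlg H c := (A.powSub K).toHAlg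

namespace pow

variable {K L M : SSet.{u}}

/-- The value of an element of `A^K` at a simplex. -/
noncomputable def val (φ : A.pow K) {n : SimplexCategoryᵒᵖ} (x : K.obj n) :
    A.tensor (SimplexRing n.unop.len) := φ.1 ⟨n, x⟩

theorem val_map (φ : A.pow K) {m n : SimplexCategoryᵒᵖ} (θ : m ⟶ n) (x : K.obj m) :
    val φ (K.map θ x) = (Hom.id A).tensor (SimplexRing.map θ.unop) (val φ x) :=
  φ.2 m n θ x

theorem ext {φ ψ : A.pow K} (h : ∀ (n : SimplexCategoryᵒᵖ) (x : K.obj n), val φ x = val ψ x) :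
    φ = ψ := Subtype.ext (funext fun s => h s.1 s.2)

@[simp] theorem val_zero {n : SimplexCategoryᵒᵖ} (x : K.obj n) : val (0 : A.pow K) x = 0 := rfl

/-- A map of simplicial sets `K → A^Δ` as an element of `A^K`. -/
noncomputable def ofMap (f : K ⟶ A.simplicial) : A.pow K :=
  ⟨fun s => f.app s.1 s.2, fun _ _ θ x => ConcreteCategory.congr_hom (f.naturality θ) x⟩

/-- An element of `A^K` as a map of simplicial sets `K → A^Δ`. -/
noncomputable def toMap (φ : A.pow K) : K ⟶ A.simplicial where
  app n := TypeCat.ofHom (fun x => val φ x)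
  naturality m n θ := by
    ext x
    exact val_map φ θ x

@[simp] theorem val_ofMap (f : K ⟶ A.simplicial) {n : SimplexCategoryᵒᵖ} (x : K.obj n) :
    val (ofMap f) x = f.app n x := rfl

@[simp] theorem toMap_app (φ : A.pow K) (n : SimplexCategoryᵒᵖ) (x : K.obj n) :
    (toMap φ).app n x = val φ x := rfl

/-- The restriction `A^L → A^K` along `K → L`. -/
noncomputable def res (A : HAlg H c) (f : K ⟶ L) : Hom (A.pow L) (A.pow K) where
  toFun φ := ⟨fun s => val φ (f.app s.1 s.2), fun m n θ x => by
    have h : f.app n (K.map θ x) = L.map θ (f.app m x) :=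
      ConcreteCategory.congr_hom (f.naturality θ) x
    change val φ (f.app n (K.map θ x)) = _
    rw [h, val_map]⟩
  map_add' _ _ := rfl
  map_mul' _ _ := rfl
  map_smul' _ _ := rfl
  map_op_smul' _ _ := rfl

@[simp] theorem val_res (f : K ⟶ L) (φ : A.pow L) {n : SimplexCategoryᵒᵖ} (x : K.obj n) :
    val (res A f φ) x = val φ (f.app n x) := rfl

theorem res_comp (f : K ⟶ L) (g : L ⟶ M) (φ : A.pow M) :
    res A (f ≫ g) φ = res A f (res A g φ) := rfl

/-- `A^K → B^K` induced by `A → B`. -/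
noncomputable def map (f : Hom A B) (K : SSet.{u}) : Hom (A.pow K) (B.pow K) where
  toFun φ := ⟨fun s => f.tensor (RingHom.id _) (val φ s.2), fun m n θ x => by
    change f.tensor (RingHom.id _) (val φ (K.map θ x)) =
      (Hom.id B).tensor (SimplexRing.map θ.unop) (f.tensor (RingHom.id _) (val φ x))
    rw [val_map]
    have h : (f.tensor (RingHom.id _)).comp ((Hom.id A).tensor (SimplexRing.map θ.unop)) =
      ((Hom.id B).tensor (SimplexRing.map θ.unop)).comp (f.tensor (RingHom.id _)) :=
      tensor_hom_ext fun _ _ => rfl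
    exact congrArg (fun g : Hom _ _ => g (val φ x)) h⟩
  map_add' φ ψ := ext fun _ x => map_add (f.tensor (RingHom.id _)) (val φ x) (val ψ x)
  map_mul' φ ψ := ext fun _ x => (f.tensor (RingHom.id _)).map_mul (val φ x) (val ψ x)
  map_smul' h φ := ext fun _ x => (f.tensor (RingHom.id _)).map_smul h (val φ x)
  map_op_smul' h φ := ext fun _ x => (f.tensor (RingHom.id _)).map_op_smul h (val φ x)

@[simp] theorem val_powMap (f : Hom A B) (φ : A.pow K) {n : SimplexCategoryᵒᵖ} (x : K.obj n) :
    val (map f K φ) x = f.tensor (RingHom.id _) (val φ x) := rfl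

theorem res_map (f : Hom A B) (g : K ⟶ L) (φ : A.pow L) :
    res B g (map f L φ) = map f K (res A g φ) := rfl

end pow

/-- For `K₀ → K`, the kernel of the restriction `A^K → A^{K₀}`.  If `K₀` is a point
this is `A^{(K,*)}`. -/
noncomputable def powRel (A : HAlg H c) {K₀ K : SSet.{u}} (b : K₀ ⟶ K) : HAlg H c :=
  (ker (pow.res A b)).toHAlg

namespace powRel

variable {K₀ K L₀ L : SSet.{u}}

/-- The inclusion of `A^{(K,*)}` in `A^K`. -/
noncomputable def incl (A : HAlg H c) (b : K₀ ⟶ K) : Hom (A.powRel b) (A.pow K) :=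
  (ker (pow.res A b)).incl

theorem incl_injective (b : K₀ ⟶ K) : Function.Injective (incl A b) := Subtype.val_injective

theorem res_incl (b : K₀ ⟶ K) (φ : A.powRel b) : pow.res A b (incl A b φ) = 0 := φ.2

/-- The restriction along a map of pairs. -/
noncomputable def res (A : HAlg H c) {b : K₀ ⟶ K} {d : L₀ ⟶ L} (f₀ : K₀ ⟶ L₀) (f : K ⟶ L)
    (w : b ≫ f = f₀ ≫ d) : Hom (A.powRel d) (A.powRel b) :=
  (ker (pow.res A b)).codRestrict ((pow.res A f).comp (incl A d)) fun φ => by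
    change pow.res A b (pow.res A f (incl A d φ)) = 0
    rw [← pow.res_comp, w, pow.res_comp, res_incl, map_zero (pow.res A f₀)]

theorem incl_res {b : K₀ ⟶ K} {d : L₀ ⟶ L} (f₀ : K₀ ⟶ L₀) (f : K ⟶ L) (w : b ≫ f = f₀ ≫ d)
    (φ : A.powRel d) : incl A b (res A f₀ f w φ) = pow.res A f (incl A d φ) := rfl

/-- The functor `A ↦ A^{(K,*)}` on homomorphisms. -/
noncomputable def map (f : Hom A B) (b : K₀ ⟶ K) : Hom (A.powRel b) (B.powRel b) :=
  (ker (pow.res B b)).codRestrict ((pow.map f K).comp (incl A b)) fun φ => by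
    change pow.res B b (pow.map f K (incl A b φ)) = 0
    rw [pow.res_map, res_incl, map_zero (pow.map f K₀)]

theorem incl_map (f : Hom A B) (b : K₀ ⟶ K) (φ : A.powRel b) :
    incl B b (map f b φ) = pow.map f K (incl A b φ) := rfl

end powRel

end HAlg

/-! ### Subdivision, the circle, and loop algebras -/

/-- The standard simplex `Δⁿ`. -/
abbrev simplex (n : ℕ) : SSet.{u} := SSet.stdSimplex.{u}.obj (SimplexCategory.mk n)

/-- The inclusion `Δ⁰ → Δ¹` of the vertex different from `i`. -/
def coface (i : Fin 2) : simplex.{u} 0 ⟶ simplex.{u} 1 := SSet.stdSimplex.{u}.δ i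

/-- The simplicial circle `Δ¹ / ∂Δ¹`. -/
noncomputable def circle : SSet.{u} := Limits.coequalizer (coface 0) (coface 1)

/-- The quotient map `Δ¹ → S¹`. -/
noncomputable def circleπ : simplex.{u} 1 ⟶ circle.{u} := Limits.coequalizer.π _ _

/-- The base point of the circle. -/
noncomputable def circleBase : simplex.{u} 0 ⟶ circle.{u} := coface 1 ≫ circleπ

theorem circleBase_eq : circleBase.{u} = coface 0 ≫ circleπ :=
  (Limits.coequalizer.condition _ _).symm

/-- The iterated subdivision `sdⁿ`. -/
noncomputable def sdIter : ℕ → SSet.{u} ⥤ SSet.{u}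
  | 0 => 𝟭 _
  | n + 1 => sdIter n ⋙ SSet.sd

/-- The largest element of a nonempty subset of `{0, …, n}`. -/
noncomputable def chainMax {n : ℕ}
    (S : PartialOrder.NonemptyFiniteChains (ULift.{u} (Fin (n + 1)))) : Fin (n + 1) :=
  (S.finset.max' S.nonempty).down

theorem chainMax_mono {n : ℕ} : Monotone (chainMax.{u} (n := n)) := fun _ _ h =>
  Finset.max'_subset _ h

theorem chainMax_map {m n : ℕ} (f : ULift.{u} (Fin (m + 1)) →o ULift.{u} (Fin (n + 1)))
    (S : PartialOrder.NonemptyFiniteChains (ULift.{u} (Fin (m + 1)))) :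
    chainMax (S.map f) = (f ⟨chainMax S⟩).down := by
  classical
  have hmem := S.finset.max'_mem S.nonempty
  refine congrArg ULift.down (le_antisymm (Finset.max'_le _ _ _ fun y hy => ?_)
    (Finset.le_max' _ _ ?_))
  · obtain ⟨x, hx, rfl⟩ := (S.mem_map_iff f y).mp hy
    exact f.monotone (Finset.le_max' _ _ hx)
  · exact (S.mem_map_iff f _).mpr ⟨_, hmem, rfl⟩

/-- The last vertex map on standard simplices: it sends a chain `S₀ ⊆ ⋯ ⊆ Sₘ` of nonempty
subsets of `[n]` to the sequence `max S₀ ≤ ⋯ ≤ max Sₘ`. -/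
noncomputable def lastVertexSimplex : SimplexCategory.sd.{u} ⟶ SSet.stdSimplex where
  app n :=
    { app := fun m => TypeCat.ofHom fun
        (x : ComposableArrows (PartialOrder.NonemptyFiniteChains (ULift.{u} (Fin (n.len + 1))))
          m.unop.len) => SSet.stdSimplex.objEquiv.symm (SimplexCategory.mkHom
            ⟨fun i => chainMax (x.obj i), fun i j h => chainMax_mono (x.monotone h)⟩)
      naturality := fun l m θ => by ext x; rfl }
  naturality n n' f := by
    ext m x
    apply SSet.stdSimplex.objEquiv.injective
    ext i
    exact congrArg Fin.val (chainMax_map (SimplexCategory.toPartOrd.map f).hom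
      (Functor.obj (D := PartialOrder.NonemptyFiniteChains (ULift.{u} (Fin (n.len + 1)))) x i))

/-- The last vertex map `sd K → K`. -/
noncomputable def lastVertex : SSet.sd.{u} ⟶ 𝟭 SSet.{u} :=
  SSet.sd.descOfIsLeftKanExtension SSet.stdSimplex.sdIso.inv (𝟭 _) lastVertexSimplex

namespace HAlg

variable {A B C : HAlg H c}

/-- The algebra `A^{(sd^q S¹, *)}`. -/
noncomputable def loop (q : ℕ) (A : HAlg H c) : HAlg H c := A.powRel ((sdIter q).map circleBase)

/-- The functor `A ↦ A^{(sd^q S¹, *)}` on homomorphisms. -/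
noncomputable def loopMap (q : ℕ) (f : Hom A B) : Hom (A.loop q) (B.loop q) := powRel.map f _

/-- The map `A^{(sd^q S¹, *)} → A^{(sd^{q+1} S¹, *)}` induced by the last vertex map. -/
noncomputable def loopStep (q : ℕ) (A : HAlg H c) : Hom (A.loop q) (A.loop (q + 1)) :=
  powRel.res A (lastVertex.app _) (lastVertex.app _)
    (lastVertex.naturality ((sdIter q).map circleBase))

theorem loopStep_loopMap (q : ℕ) (f : Hom A B) (φ : A.loop q) :
    loopStep q B (loopMap q f φ) = loopMap (q + 1) f (loopStep q A φ) := rfl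

/-- The transition maps of the ind-algebra `A^{S¹} = (A^{(sd^q S¹, *)})_q`. -/
noncomputable def loopTrans {q q' : ℕ} (h : q ≤ q') (A : HAlg H c) : Hom (A.loop q) (A.loop q') :=
  Nat.leRecOn (C := fun m => Hom (A.loop q) (A.loop m)) h (fun g => (loopStep _ A).comp g)
    (Hom.id _)

theorem loopTrans_self (q : ℕ) (A : HAlg H c) : loopTrans le_rfl A = Hom.id (A.loop q) :=
  Nat.leRecOn_self _

theorem loopTrans_succ {q q' : ℕ} (h : q ≤ q') (A : HAlg H c) :
    loopTrans (Nat.le_succ_of_le h) A = (loopStep q' A).comp (loopTrans h A) :=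
  Nat.leRecOn_succ h _

theorem loopTrans_loopMap {q q' : ℕ} (h : q ≤ q') (f : Hom A B) :
    (loopTrans h B).comp (loopMap q f) = (loopMap q' f).comp (loopTrans h A) := by
  induction h with
  | refl => rw [loopTrans_self, loopTrans_self]; rfl
  | step h ih =>
    have e : (loopStep _ B).comp ((loopTrans h B).comp (loopMap q f)) =
      (loopStep _ B).comp ((loopMap _ f).comp (loopTrans h A)) := congrArg _ ih
    rw [loopTrans_succ h, loopTrans_succ h]
    exact e

/-! ### The path extension -/

/-- The path algebra `A^{(Δ¹, *)}`, the base point being the vertex `0`. -/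
noncomputable def path (A : HAlg H c) : HAlg H c := A.powRel (coface 1)

/-- The fundamental simplex of `Δ⁰`. -/
def pt : (simplex.{u} 0).obj (Opposite.op (SimplexCategory.mk 0)) :=
  SSet.stdSimplex.objEquiv.symm (𝟙 _)

/-- The isomorphism `A^{Δ⁰} → A ⊗ ℤ^{Δ⁰}`. -/
noncomputable def valPt (A : HAlg H c) : Hom (A.pow (simplex.{u} 0)) (A.tensor (SimplexRing 0)) where
  toFun φ := pow.val (n := Opposite.op (SimplexCategory.mk 0)) φ pt
  map_add' _ _ := rfl
  map_mul' _ _ := rfl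
  map_smul' _ _ := rfl
  map_op_smul' _ _ := rfl

/-- The isomorphism `A^{Δ⁰} → A`. -/
noncomputable def evalPt (A : HAlg H c) : Hom (A.pow (simplex.{u} 0)) A :=
  (A.tensorEval SimplexRing.aug).comp A.valPt

/-- The evaluation of paths at the vertex `1`. -/
noncomputable def pathEnd (A : HAlg H c) : Hom A.path A :=
  A.evalPt.comp ((pow.res A (coface 0)).comp (powRel.incl A _))

theorem tmul_tensorEval_aug (x : A.tensor (SimplexRing 0)) :
    tmul (A.tensorEval SimplexRing.aug x) (1 : SimplexRing 0) = x := by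
  induction x using tensor_induction with
  | h0 => rw [map_zero (A.tensorEval SimplexRing.aug)]; exact TensorProduct.zero_tmul _ _
  | h a r =>
    rw [tensorEval_tmul]
    refine (TensorProduct.smul_tmul (SimplexRing.aug r) a (1 : SimplexRing 0)).trans ?_
    rw [zsmul_one, SimplexRing.intCast_aug]
    rfl
  | hadd x y hx hy =>
    rw [map_add (A.tensorEval SimplexRing.aug)]
    refine (TensorProduct.add_tmul _ _ _).trans ?_
    exact congrArg₂ (· + ·) hx hy

theorem evalPt_eq_zero (φ : A.pow (simplex.{u} 0)) (h : A.evalPt φ = 0) : φ = 0 := by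
  have h0 : A.valPt φ = 0 := by
    rw [← tmul_tensorEval_aug (A.valPt φ)]
    refine Eq.trans ?_ (TensorProduct.zero_tmul A (1 : SimplexRing 0))
    exact congrArg (fun a => tmul a (1 : SimplexRing 0)) h
  refine pow.ext fun n x => ?_
  have hx : x = (simplex.{u} 0).map (SSet.stdSimplex.objEquiv x).op pt := by
    apply SSet.stdSimplex.objEquiv.injective
    ext i
    rfl
  rw [hx, pow.val_map]
  exact (congrArg ((Hom.id A).tensor _) h0).trans (map_zero ((Hom.id A).tensor _))

/-- The path `a ⊗ t₁` from `0` to `a`. -/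
noncomputable def linePow (a : A) : A.pow (simplex.{u} 1) :=
  ⟨fun s => tmul a (SimplexRing.map (SSet.stdSimplex.objEquiv s.2)
      (SimplexRing.t (1 : Fin 2))), fun m n θ x => by
    refine Eq.trans ?_ (Hom.tensor_tmul (Hom.id A) (SimplexRing.map θ.unop) a
      (SimplexRing.map (SSet.stdSimplex.objEquiv x) (SimplexRing.t (1 : Fin 2)))).symm
    rw [Hom.id_apply, ← RingHom.comp_apply, ← SimplexRing.map_comp]
    rfl⟩

open Classical in
theorem valPt_linePow (i : Fin 2) (a : A) :
    A.valPt (pow.res A (coface i) (linePow a)) =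
      tmul a (∑ j with SimplexCategory.Hom.toOrderHom (SimplexCategory.δ i) j = (1 : Fin 2),
        SimplexRing.t j) :=
  congrArg (tmul a) (SimplexRing.map_t (SimplexCategory.δ i) (1 : Fin 2))

theorem res_linePow (a : A) : pow.res A (coface 1) (linePow a) = 0 := by
  classical
  apply evalPt_eq_zero
  rw [evalPt, Hom.comp_apply, valPt_linePow, Finset.sum_eq_zero,
    ← map_zero (A.tensorEval SimplexRing.aug)]
  · exact congrArg _ (TensorProduct.tmul_zero _ _)
  · intro j hj
    have hj0 : j = 0 := Fin.fin_one_eq_zero j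
    subst hj0
    simp only [Finset.mem_filter] at hj
    exact absurd hj.2 (by decide)

theorem evalPt_linePow (a : A) : A.evalPt (pow.res A (coface 0) (linePow a)) = a := by
  classical
  have : (∑ j with SimplexCategory.Hom.toOrderHom (SimplexCategory.δ (0 : Fin 2)) j =
      (1 : Fin 2), SimplexRing.t j : SimplexRing 0) = 1 := by
    rw [Finset.filter_true_of_mem, SimplexRing.sum_t]
    intro j _
    have hj0 : j = 0 := Fin.fin_one_eq_zero j
    subst hj0
    decide
  rw [evalPt, Hom.comp_apply, valPt_linePow, this, tensorEval_tmul, map_one, one_smul]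

theorem linePow_add (a b : A) : linePow (a + b) = linePow a + linePow b :=
  pow.ext fun _ _ => TensorProduct.add_tmul _ _ _

theorem circle_hom_ext {φ ψ : A.pow circle}
    (h : pow.res A circleπ φ = pow.res A circleπ ψ) : φ = ψ := by
  have : pow.toMap φ = pow.toMap ψ := by
    refine Limits.coequalizer.hom_ext ?_
    exact congrArg pow.toMap h
  exact congrArg pow.ofMap this

/-- The loop extension `ΩA → PA → A` with `ΩA = A^{(S¹, *)}` and `PA = A^{(Δ¹, *)}`; the section
sends `a` to the path `a ⊗ t₁`. -/
noncomputable def loopExt (U : Underlying) (A : HAlg H c) :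
    SplitExt U (A.powRel circleBase) A.path A where
  i := powRel.res A (𝟙 _) circleπ (Category.id_comp _).symm
  p := A.pathEnd
  s a := ⟨linePow a, res_linePow a⟩
  injective φ ψ h := powRel.incl_injective _ (circle_hom_ext (congrArg (powRel.incl A _) h))
  p_i φ := by
    have h : pow.res A (coface 0) (pow.res A circleπ (powRel.incl A circleBase φ)) = 0 := by
      rw [← pow.res_comp, ← circleBase_eq, powRel.res_incl]
    exact (congrArg A.evalPt h).trans (map_zero A.evalPt)
  exact φ h := by
    have h0 := evalPt_eq_zero _ h
    have h1 := powRel.res_incl _ φ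
    have hw : coface 0 ≫ pow.toMap (powRel.incl A _ φ) =
        coface 1 ≫ pow.toMap (powRel.incl A _ φ) :=
      congrArg pow.toMap (h0.trans h1.symm)
    have hπ : pow.res A circleπ (pow.ofMap (Limits.coequalizer.desc _ hw)) =
        powRel.incl A _ φ :=
      congrArg pow.ofMap (Limits.coequalizer.π_desc _ hw)
    refine ⟨⟨pow.ofMap (Limits.coequalizer.desc _ hw), ?_⟩, powRel.incl_injective _ hπ⟩
    change pow.res A circleBase _ = 0
    rw [circleBase, pow.res_comp, hπ, h1]
  isHom := by
    cases U
    · trivial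
    · exact ⟨fun a b => Subtype.ext (linePow_add a b),
        fun h a => Subtype.ext (pow.ext fun _ _ => (smul_tmul h a _).symm),
        fun h a => Subtype.ext (pow.ext fun _ _ => (op_smul_tmul h a _).symm)⟩
    · exact fun a b => Subtype.ext (linePow_add a b)
  s_zero := Subtype.ext (pow.ext fun _ _ => TensorProduct.zero_tmul _ _)
  p_s := evalPt_linePow

end HAlg

/-! ### Matrices -/

/-- The underlying group of the matrices with entries in `A` whose rows and columns are indexed by
`ι` and which have only finitely many nonzero entries. -/
def MatCarrier (ι : Type) (A : HAlg H c) : Type u := ι × ι →₀ A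

namespace MatCarrier

noncomputable instance (ι : Type) (A : HAlg H c) : AddCommGroup (MatCarrier ι A) :=
  inferInstanceAs (AddCommGroup (ι × ι →₀ A))

noncomputable instance (ι : Type) (A : HAlg H c) : Module H (MatCarrier ι A) :=
  inferInstanceAs (Module H (ι × ι →₀ A))

noncomputable instance (ι : Type) (A : HAlg H c) : Module Hᵐᵒᵖ (MatCarrier ι A) :=
  inferInstanceAs (Module Hᵐᵒᵖ (ι × ι →₀ A))

instance (ι : Type) (A : HAlg H c) : SMulCommClass H Hᵐᵒᵖ (MatCarrier ι A) :=
  inferInstanceAs (SMulCommClass H Hᵐᵒᵖ (ι × ι →₀ A))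

variable {ι : Type} {A : HAlg H c}

/-- The matrix with the only nonzero entry `a` in row `i` and column `j`. -/
noncomputable def single (i j : ι) : A →+ MatCarrier ι A := Finsupp.singleAddHom (i, j)

/-- The entries of a matrix. -/
def entry (x : MatCarrier ι A) (i j : ι) : A := (show ι × ι →₀ A from x) (i, j)

theorem ext {x y : MatCarrier ι A} (h : ∀ i j, entry x i j = entry y i j) : x = y :=
  Finsupp.ext fun p => h p.1 p.2

theorem addHom_ext {G : Type*} [AddCommMonoid G] {f g : MatCarrier ι A →+ G}
    (h : ∀ i j a, f (single i j a) = g (single i j a)) : f = g :=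
  Finsupp.addHom_ext (f := f) (g := g) fun p a => h p.1 p.2 a

open Classical in
/-- Matrix multiplication: `(a eᵢⱼ) (b eₖₗ)` is `ab eᵢₗ` if `j = k`, and `0` otherwise. -/
noncomputable def mulHom : MatCarrier ι A →+ MatCarrier ι A →+ MatCarrier ι A :=
  Finsupp.liftAddHom fun p => AddMonoidHom.flip (Finsupp.liftAddHom fun q =>
    if p.2 = q.1 then
      ((AddMonoidHom.compHom (single p.1 q.2)).comp (AddMonoidHom.mul (R := A))).flip else 0)

open Classical in
theorem mulHom_single (i j k l : ι) (a b : A) :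
    mulHom (single i j a) (single k l b) = if j = k then single i l (a * b) else 0 := by
  have h := DFunLike.congr_fun (Finsupp.liftAddHom_apply_single (M := A) (fun p : ι × ι =>
    AddMonoidHom.flip (Finsupp.liftAddHom (M := A) fun q : ι × ι => if p.2 = q.1 then
      ((AddMonoidHom.compHom (single p.1 q.2)).comp (AddMonoidHom.mul (R := A))).flip else 0))
    (i, j) a) (Finsupp.single (k, l) b)
  refine h.trans ?_
  have h' := DFunLike.congr_fun (Finsupp.liftAddHom_apply_single (M := A) (fun q : ι × ι =>
    if j = q.1 then ((AddMonoidHom.compHom (single i q.2)).comp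
      (AddMonoidHom.mul (R := A))).flip else 0) (k, l) b) a
  refine h'.trans ?_
  split_ifs <;> rfl

theorem single_induction {P : MatCarrier ι A → Prop} (h0 : P 0)
    (hs : ∀ i j a, P (single i j a)) (hadd : ∀ x y, P x → P y → P (x + y)) (x) : P x :=
  Finsupp.induction_linear (motive := P) x h0 hadd fun p a => hs p.1 p.2 a

theorem smul_single (h : H) (i j : ι) (a : A) : h • single i j a = single i j (h • a) :=
  Finsupp.smul_single h (i, j) a

theorem op_smul_single (h : H) (i j : ι) (a : A) :
    op h • single i j a = single i j (op h • a) :=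
  Finsupp.smul_single (op h) (i, j) a

theorem mulHom_smul (h : H) (x y : MatCarrier ι A) : mulHom (h • x) y = h • mulHom x y := by
  induction x using single_induction with
  | h0 => rw [smul_zero, map_zero, AddMonoidHom.zero_apply, smul_zero]
  | hadd x x' hx hx' =>
    rw [smul_add, map_add, AddMonoidHom.add_apply, hx, hx', map_add, AddMonoidHom.add_apply,
      smul_add]
  | hs i j a =>
    induction y using single_induction with
    | h0 => rw [map_zero, map_zero, smul_zero]
    | hadd y y' hy hy' => rw [map_add, map_add, hy, hy', smul_add]
    | hs k l b =>
      rw [smul_single, mulHom_single, mulHom_single]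
      split_ifs
      · rw [smul_single, A.smul_mul]
      · rw [smul_zero]

theorem mulHom_op_smul (h : H) (x y : MatCarrier ι A) :
    mulHom x (op h • y) = op h • mulHom x y := by
  induction x using single_induction with
  | h0 => rw [map_zero, AddMonoidHom.zero_apply, AddMonoidHom.zero_apply, smul_zero]
  | hadd x x' hx hx' =>
    rw [map_add, AddMonoidHom.add_apply, hx, hx', AddMonoidHom.add_apply, smul_add]
  | hs i j a =>
    induction y using single_induction with
    | h0 => rw [smul_zero, map_zero, smul_zero]
    | hadd y y' hy hy' => rw [smul_add, map_add, map_add, hy, hy', smul_add]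
    | hs k l b =>
      rw [op_smul_single, mulHom_single, mulHom_single]
      split_ifs
      · rw [op_smul_single, A.mul_op_smul]
      · rw [smul_zero]

theorem mulHom_op_smul_left (h : H) (x y : MatCarrier ι A) :
    mulHom (op h • x) y = mulHom x (h • y) := by
  induction x using single_induction with
  | h0 => rw [smul_zero, map_zero, AddMonoidHom.zero_apply, AddMonoidHom.zero_apply]
  | hadd x x' hx hx' =>
    rw [smul_add, map_add, AddMonoidHom.add_apply, hx, hx', map_add, AddMonoidHom.add_apply]
  | hs i j a =>
    induction y using single_induction with
    | h0 => rw [smul_zero, map_zero, map_zero]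
    | hadd y y' hy hy' => rw [smul_add, map_add, map_add, hy, hy']
    | hs k l b =>
      rw [op_smul_single, smul_single, mulHom_single, mulHom_single, A.op_smul_mul]

theorem mulHom_assoc (x y z : MatCarrier ι A) :
    mulHom (mulHom x y) z = mulHom x (mulHom y z) := by
  classical
  induction x using single_induction with
  | h0 => simp only [map_zero, AddMonoidHom.zero_apply]
  | hadd x x' hx hx' => simp only [map_add, AddMonoidHom.add_apply, hx, hx']
  | hs i j a =>
    induction y using single_induction with
    | h0 => simp only [map_zero, AddMonoidHom.zero_apply]
    | hadd y y' hy hy' => simp only [map_add, AddMonoidHom.add_apply, hy, hy']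
    | hs k l b =>
      induction z using single_induction with
      | h0 => simp only [map_zero]
      | hadd z z' hz hz' => simp only [map_add, hz, hz']
      | hs p q d =>
        by_cases hjk : j = k <;> by_cases hlp : l = p <;>
          simp [mulHom_single, hjk, hlp, mul_assoc]

/-- The map of matrices that applies `f` to all entries. -/
noncomputable def mapEntries {B : HAlg H c} (f : A → B) (hf : f 0 = 0) (x : MatCarrier ι A) :
    MatCarrier ι B := Finsupp.mapRange f hf x

@[simp] theorem entry_mapEntries {B : HAlg H c} (f : A → B) (hf : f 0 = 0) (x : MatCarrier ι A)
    (i j : ι) : entry (mapEntries f hf x) i j = f (entry x i j) := rfl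

@[simp] theorem entry_add (x y : MatCarrier ι A) (i j : ι) :
    entry (x + y) i j = entry x i j + entry y i j := rfl

@[simp] theorem entry_zero (i j : ι) : entry (0 : MatCarrier ι A) i j = 0 := rfl

@[simp] theorem entry_smul (h : H) (x : MatCarrier ι A) (i j : ι) :
    entry (h • x) i j = h • entry x i j := rfl

@[simp] theorem entry_op_smul (h : H) (x : MatCarrier ι A) (i j : ι) :
    entry (op h • x) i j = op h • entry x i j := rfl

theorem mapEntries_single {B : HAlg H c} (f : A → B) (hf : f 0 = 0) (i j : ι) (a : A) :
    mapEntries f hf (single i j a) = single i j (f a) := Finsupp.mapRange_single (hf := hf)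

theorem map_mulHom_of_single {κ : Type} {B : HAlg H c} (E : MatCarrier ι A →+ MatCarrier κ B)
    (hE : ∀ i j a k l b, E (mulHom (single i j a) (single k l b)) =
      mulHom (E (single i j a)) (E (single k l b))) (x y : MatCarrier ι A) :
    E (mulHom x y) = mulHom (E x) (E y) := by
  induction x using single_induction with
  | h0 => simp only [map_zero, AddMonoidHom.zero_apply]
  | hadd x x' hx hx' => simp only [map_add, AddMonoidHom.add_apply, hx, hx']
  | hs i j a =>
    induction y using single_induction with
    | h0 => simp only [map_zero]
    | hadd y y' hy hy' => simp only [map_add, hy, hy']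
    | hs k l b => exact hE i j a k l b

/-- The extension of a matrix by zero along an injection of the index sets. -/
noncomputable def emb {κ : Type} (e : ι ↪ κ) : MatCarrier ι A →+ MatCarrier κ A :=
  Finsupp.embDomain.addMonoidHom (M := A) (e.prodMap e)

theorem emb_single {κ : Type} (e : ι ↪ κ) (i j : ι) (a : A) :
    emb e (single i j a) = single (e i) (e j) a := Finsupp.embDomain_single _ _ _

theorem emb_mulHom {κ : Type} (e : ι ↪ κ) (x y : MatCarrier ι A) :
    emb e (mulHom x y) = mulHom (emb e x) (emb e y) := by
  refine map_mulHom_of_single (emb e) (fun i j a k l b => ?_) x y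
  rw [emb_single, emb_single, mulHom_single, mulHom_single]
  by_cases h : j = k
  · rw [if_pos h, if_pos (congrArg e h), emb_single]
  · rw [if_neg h, if_neg (fun h' => h (e.injective h')), map_zero]

theorem emb_smul {κ : Type} (e : ι ↪ κ) (h : H) (x : MatCarrier ι A) :
    emb e (h • x) = h • emb e x := by
  induction x using single_induction with
  | h0 => rw [smul_zero, map_zero, smul_zero]
  | hadd x x' hx hx' => rw [smul_add, map_add, map_add, hx, hx', smul_add]
  | hs i j a => rw [smul_single, emb_single, emb_single, smul_single]

theorem emb_op_smul {κ : Type} (e : ι ↪ κ) (h : H) (x : MatCarrier ι A) :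
    emb e (op h • x) = op h • emb e x := by
  induction x using single_induction with
  | h0 => rw [smul_zero, map_zero, smul_zero]
  | hadd x x' hx hx' => rw [smul_add, map_add, map_add, hx, hx', smul_add]
  | hs i j a => rw [op_smul_single, emb_single, emb_single, op_smul_single]

end MatCarrier

open MatCarrier in
/-- The algebra of matrices with entries in `A`, with rows and columns indexed by `ι`, and with
only finitely many nonzero entries.  For `ι = Fin n` it is `Mₙ A`, for `ι = ℕ` it is `M_∞ A`. -/
noncomputable def Mat (ι : Type) (A : HAlg H c) : HAlg H c :=
  letI : Mul (MatCarrier ι A) := ⟨fun x y => mulHom x y⟩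
  letI : NonUnitalRing (MatCarrier ι A) :=
    { (inferInstance : AddCommGroup (MatCarrier ι A)), (inferInstance : Mul (MatCarrier ι A)) with
      left_distrib := fun x y z => map_add (mulHom x) y z
      right_distrib := fun x y z => DFunLike.congr_fun (map_add mulHom x y) z
      zero_mul := fun x => DFunLike.congr_fun (map_zero mulHom) x
      mul_zero := fun x => map_zero (mulHom x)
      mul_assoc := mulHom_assoc }
  { carrier := MatCarrier ι A
    smul_mul := mulHom_smul
    mul_op_smul := mulHom_op_smul
    op_smul_mul := mulHom_op_smul_left
    op_smul_of_central := fun hc h _ => MatCarrier.ext fun _ _ => A.op_smul_of_central hc h _ }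

namespace Mat

open MatCarrier

variable {ι κ : Type} {A B C : HAlg H c}

/-- The functor `A ↦ M_ι A` on homomorphisms. -/
noncomputable def map (ι : Type) (f : Hom A B) : Hom (Mat ι A) (Mat ι B) where
  toFun := mapEntries f (map_zero f)
  map_add' x y := MatCarrier.ext fun i j => map_add f (entry x i j) (entry y i j)
  map_mul' := map_mulHom_of_single
    { toFun := mapEntries f (map_zero f)
      map_zero' := MatCarrier.ext fun i j => map_zero f
      map_add' := fun x y => MatCarrier.ext fun i j => map_add f (entry x i j) (entry y i j) }
    (fun i j a k l b => by
      change mapEntries f (map_zero f) _ =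
        mulHom (mapEntries f (map_zero f) _) (mapEntries f (map_zero f) _)
      rw [mapEntries_single, mapEntries_single, mulHom_single, mulHom_single]
      split_ifs
      · rw [mapEntries_single, f.map_mul]
      · exact MatCarrier.ext fun i j => map_zero f)
  map_smul' h x := MatCarrier.ext fun i j => f.map_smul h (entry x i j)
  map_op_smul' h x := MatCarrier.ext fun i j => f.map_op_smul h (entry x i j)

theorem hom_ext {f g : Hom (Mat ι A) B}
    (h : ∀ i j a, f (single i j a : MatCarrier ι A) = g (single i j a : MatCarrier ι A)) :
    f = g := by
  refine Hom.ext' fun x => ?_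
  induction x using single_induction with
  | h0 => exact (map_zero f).trans (map_zero g).symm
  | hadd x y hx hy =>
    exact (map_add f _ _).trans ((congrArg₂ (· + ·) hx hy).trans (map_add g _ _).symm)
  | hs i j a => exact h i j a

/-- The homomorphism `M_ι A → M_κ A` induced by an injection `ι → κ`. -/
noncomputable def reindex (e : ι ↪ κ) (A : HAlg H c) : Hom (Mat ι A) (Mat κ A) where
  toFun := emb (A := A) e
  map_add' := map_add (emb e)
  map_mul' := emb_mulHom e
  map_smul' := emb_smul e
  map_op_smul' := emb_op_smul e

theorem reindex_single (e : ι ↪ κ) (i j : ι) (a : A) :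
    reindex e A (single i j a : MatCarrier ι A) = (single (e i) (e j) a : MatCarrier κ A) :=
  emb_single e i j a

theorem reindex_map (e : ι ↪ κ) (f : Hom A B) :
    (reindex e B).comp (map ι f) = (map κ f).comp (reindex e A) :=
  hom_ext fun i j a => by
    have h1 : map ι f (single i j a : MatCarrier ι A) = (single i j (f a) : MatCarrier ι B) :=
      mapEntries_single f (map_zero f) i j a
    have h2 : map κ f (single (e i) (e j) a : MatCarrier κ A) =
      (single (e i) (e j) (f a) : MatCarrier κ B) := mapEntries_single f (map_zero f) _ _ a
    exact (congrArg (reindex e B) h1).trans ((reindex_single e i j (f a)).trans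
      (h2.symm.trans (congrArg (map κ f) (reindex_single e i j a).symm)))

theorem map_comp (g : Hom B C) (f : Hom A B) : map ι (g.comp f) = (map ι g).comp (map ι f) :=
  Hom.ext' fun _ => MatCarrier.ext fun _ _ => rfl

/-- The homomorphism `A → M_ι A`, `a ↦ a eᵢᵢ`. -/
noncomputable def corner (i : ι) (A : HAlg H c) : Hom A (Mat ι A) where
  toFun := fun a => (single i i a : MatCarrier ι A)
  map_add' := map_add (single (A := A) i i)
  map_mul' a b := ((mulHom_single i i i i a b).trans (if_pos rfl)).symm
  map_smul' h a := (smul_single h i i a).symm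
  map_op_smul' h a := (op_smul_single h i i a).symm

theorem map_corner (i : ι) (f : Hom A B) :
    (map ι f).comp (corner i A) = (corner i B).comp f :=
  Hom.ext' fun a => mapEntries_single f (map_zero f) i i a

end Mat

open Classical MatCarrier in
/-- Matrices with entries in a split extension form a split extension; the section is applied to
the entries. -/
noncomputable def SplitExt.mat (ι : Type) {U : Underlying} {K E C : HAlg H c}
    (X : SplitExt U K E C) : SplitExt U (Mat ι K) (Mat ι E) (Mat ι C) where
  i := Mat.map ι X.i
  p := Mat.map ι X.p
  s := mapEntries X.s X.s_zero
  injective x y h := MatCarrier.ext fun i j =>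
    X.injective (congrArg (fun z : MatCarrier ι E => entry z i j) h)
  p_i x := MatCarrier.ext fun _ _ => X.p_i _
  exact x hx := by
    let g : E → K := fun e => if h : ∃ k, X.i k = e then h.choose else 0
    have hg (e : E) (h : X.p e = 0) : X.i (g e) = e := by
      have h' := X.exact e h
      simp only [g, dif_pos h']
      exact h'.choose_spec
    have g0 : g 0 = 0 := X.injective ((hg 0 (map_zero X.p)).trans (map_zero X.i).symm)
    refine ⟨mapEntries g g0 x, MatCarrier.ext fun i j => hg _ ?_⟩
    exact congrArg (fun z : MatCarrier ι C => entry z i j) hx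
  isHom := by
    have hX := X.isHom
    cases U
    · trivial
    · exact ⟨fun x y => MatCarrier.ext fun i j => hX.1 _ _,
        fun h x => MatCarrier.ext fun i j => hX.2.1 _ _,
        fun h x => MatCarrier.ext fun i j => hX.2.2 _ _⟩
    · exact fun x y => MatCarrier.ext fun i j => hX _ _
  s_zero := MatCarrier.ext fun _ _ => X.s_zero
  p_s x := MatCarrier.ext fun _ _ => X.p_s _

/-! ### Stabilisation by matrices, spheres, and the groups `kk` -/

theorem SplitExt.classify_natural {U : Underlying} {K E C K' E' C' : HAlg H c}
    (X : SplitExt U K E C) (X' : SplitExt U K' E' C') (k : Hom K K') (e : Hom E E') (g : Hom C C')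
    (hi : ∀ x, e (X.i x) = X'.i (k x)) (hs : ∀ x, e (X.s x) = X'.s (g x)) :
    k.comp X.classify = X'.classify.comp (J.map U g) := by
  refine Hom.ext' fun x => X'.injective ?_
  have h : e.comp X.liftT = X'.liftT.comp (T.map U g) := T.hom_ext fun a => hs a
  rw [Hom.comp_apply, Hom.comp_apply, ← hi, X.i_classify, X'.i_classify, J.incl_map]
  exact congrArg (fun q : Hom _ _ => q (J.incl U C x)) h

/-- The terms `M_{k+1} M_∞ A` of the stabilisation `M_• M_∞ A`. -/
noncomputable def stab (k : ℕ) (A : HAlg H c) : HAlg H c := Mat (Fin (k + 1)) (Mat ℕ A)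

/-- The functor `M_{k+1} M_∞` on homomorphisms. -/
noncomputable def stabMap (k : ℕ) {A B : HAlg H c} (f : Hom A B) : Hom (stab k A) (stab k B) :=
  Mat.map _ (Mat.map _ f)

/-- The inclusions `M_{k+1} M_∞ A → M_{l+1} M_∞ A` in the upper left corner. -/
noncomputable def stabTrans {k l : ℕ} (h : k ≤ l) (A : HAlg H c) : Hom (stab k A) (stab l A) :=
  Mat.reindex (Fin.castLEEmb (Nat.succ_le_succ h)) _

theorem stabMap_comp (k : ℕ) {A B C : HAlg H c} (g : Hom B C) (f : Hom A B) :
    stabMap k (g.comp f) = (stabMap k g).comp (stabMap k f) := by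
  rw [stabMap, Mat.map_comp, Mat.map_comp]; rfl

theorem stabTrans_natural {k l : ℕ} (h : k ≤ l) {A B : HAlg H c} (f : Hom A B) :
    (stabTrans h B).comp (stabMap k f) = (stabMap l f).comp (stabTrans h A) :=
  Mat.reindex_map _ _

/-- The map `A → M_1 M_∞ A` to the upper left corner. -/
noncomputable def stabIncl (A : HAlg H c) : Hom A (stab 0 A) :=
  (Mat.corner 0 _).comp (Mat.corner 0 A)

/-- The classifying map `J(M_{k+1} M_∞ A) → M_{k+1} M_∞ ΩA` of the extension
`M_{k+1} M_∞ ΩA → M_{k+1} M_∞ PA → M_{k+1} M_∞ A` that is obtained from the loop extension. -/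
noncomputable def stabRho (U : Underlying) (k : ℕ) (A : HAlg H c) :
    Hom (J U (stab k A)) (stab k (A.loop 0)) :=
  (((A.loopExt U).mat ℕ).mat (Fin (k + 1))).classify

theorem stabRho_natural (U : Underlying) (k : ℕ) {A B : HAlg H c} (f : Hom A B) :
    (stabMap k (HAlg.loopMap 0 f)).comp (stabRho U k A) =
      (stabRho U k B).comp (J.map U (stabMap k f)) :=
  SplitExt.classify_natural _ _ _ (stabMap k (powRel.map f (coface 1))) _ (fun _ =>
    MatCarrier.ext fun _ _ => MatCarrier.ext fun _ _ => rfl) fun _ =>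
    MatCarrier.ext fun _ _ => MatCarrier.ext fun _ _ => Subtype.ext (pow.ext fun _ _ => rfl)

/-- The index set of the ind-algebra `A^{Sⁿ}`. -/
def SphereIndex : ℕ → Type
  | 0 => Unit
  | n + 1 => ℕ × SphereIndex n

/-- The componentwise order of the index set of `A^{Sⁿ}`. -/
def SphereIndex.Le : {n : ℕ} → SphereIndex n → SphereIndex n → Prop
  | 0, _, _ => True
  | _ + 1, (q, p), (q', p') => q ≤ q' ∧ SphereIndex.Le p p'

/-- The terms of the ind-algebra `A^{Sⁿ}`, where `A^{S^{n+1}} = (A^{Sⁿ})^{S¹}`. -/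
noncomputable def sphere : {n : ℕ} → SphereIndex n → HAlg H c → HAlg H c
  | 0, _, A => A
  | _ + 1, (q, p), A => (sphere p A).loop q

/-- The functor `A ↦ A^{Sⁿ}` on homomorphisms. -/
noncomputable def sphereMap : {n : ℕ} → (p : SphereIndex n) → {A B : HAlg H c} → Hom A B →
    Hom (sphere p A) (sphere p B)
  | 0, _, _, _, f => f
  | _ + 1, (q, p), _, _, f => HAlg.loopMap q (sphereMap p f)

/-- The transition maps of the ind-algebra `A^{Sⁿ}`. -/
noncomputable def sphereTrans : {n : ℕ} → {p p' : SphereIndex n} → p.Le p' → (A : HAlg H c) →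
    Hom (sphere p A) (sphere p' A)
  | 0, _, _, _, A => Hom.id A
  | _ + 1, (_, p), (q', _), h, A =>
    (HAlg.loopMap q' (sphereTrans h.2 A)).comp (HAlg.loopTrans h.1 (sphere p A))

theorem loopMap_comp (q : ℕ) {A B C : HAlg H c} (g : Hom B C) (f : Hom A B) :
    HAlg.loopMap q (g.comp f) = (HAlg.loopMap q g).comp (HAlg.loopMap q f) :=
  Hom.ext' fun φ => Subtype.ext (pow.ext fun _ x =>
    congrArg (fun e : Hom _ _ => e (pow.val φ.1 x))
      (Hom.tensor_comp g f (RingHom.id _) (RingHom.id _)))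

theorem sphereTrans_natural : {n : ℕ} → {p p' : SphereIndex n} → (h : p.Le p') → {A B : HAlg H c} →
    (f : Hom A B) →
    (sphereTrans h B).comp (sphereMap p f) = (sphereMap p' f).comp (sphereTrans h A)
  | 0, _, _, _, _, _, _ => rfl
  | _ + 1, (q, p), (q', p'), h, A, B, f => by
    have ih := congrArg (HAlg.loopMap q') (sphereTrans_natural h.2 f)
    rw [loopMap_comp, loopMap_comp] at ih
    have h1 := HAlg.loopTrans_loopMap h.1 (sphereMap p f)
    exact (congrArg (HAlg.loopMap q' (sphereTrans h.2 B)).comp h1).trans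
      (congrArg (fun g => Hom.comp g (HAlg.loopTrans h.1 (sphere p A))) ih)

/-- The elements of the sets of which `kk(A, B)` is the colimit: homomorphisms from `Jⁿ(A)` to a
term of the ind-algebra `M_• M_∞ B^{Sⁿ}`. -/
structure KKRep (U : Underlying) (A B : HAlg H c) where
  n : ℕ
  k : ℕ
  p : SphereIndex n
  hom : Hom (J.iter U n A) (stab k (sphere p B))

/-- The relation that generates the equivalence relation defining `kk(A, B)`: elementary
homotopies, the transition maps of the ind-algebra `M_• M_∞ B^{Sⁿ}`, and the maps from the `n`-th to
the `(n+1)`-st term of the colimit defining `kk`. -/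
inductive KKRep.Rel (U : Underlying) (A B : HAlg H c) : KKRep U A B → KKRep U A B → Prop
  | homotopy {n k : ℕ} {p : SphereIndex n} (f g : Hom (J.iter U n A) (stab k (sphere p B))) :
      ElemHomotopic f g → Rel U A B ⟨n, k, p, f⟩ ⟨n, k, p, g⟩
  | trans {n k l : ℕ} {p q : SphereIndex n} (hk : k ≤ l) (hp : p.Le q)
      (f : Hom (J.iter U n A) (stab k (sphere p B))) :
      Rel U A B ⟨n, k, p, f⟩
        ⟨n, l, q, ((stabTrans hk (sphere q B)).comp (stabMap k (sphereTrans hp B))).comp f⟩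
  | susp {n k : ℕ} {p : SphereIndex n} (f : Hom (J.iter U n A) (stab k (sphere p B))) :
      Rel U A B ⟨n, k, p, f⟩
        ⟨n + 1, k, (0, p), (stabRho U k (sphere p B)).comp (J.map U f)⟩

/-- The set `kk(A, B) = colimₙ {Jⁿ(A), B^{Sⁿ}}`, where `{A, B} = [A, M_• M_∞ B]` is the set of
homotopy classes of homomorphisms of ind-algebras. -/
def KK (U : Underlying) (A B : HAlg H c) : Type u := Quot (KKRep.Rel U A B)

theorem ElemHomotopic.comp_right {A B C : HAlg H c} {f g : Hom B C} (h : ElemHomotopic f g)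
    (e : Hom A B) : ElemHomotopic (f.comp e) (g.comp e) := by
  obtain ⟨h, rfl, rfl⟩ := h
  exact ⟨h.comp e, rfl, rfl⟩

theorem HAlg.ev_tensor {A B : HAlg H c} (e : Hom A B) (k : ℤ) :
    (B.ev k).comp (e.tensor (RingHom.id (Polynomial ℤ))) = e.comp (A.ev k) :=
  tensor_hom_ext fun a r => by
    change Polynomial.eval k r • e a = e (Polynomial.eval k r • a)
    rw [map_zsmul e]

theorem ElemHomotopic.comp_left {A B C : HAlg H c} {f g : Hom A B} (h : ElemHomotopic f g)
    (e : Hom B C) : ElemHomotopic (e.comp f) (e.comp g) := by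
  obtain ⟨h, rfl, rfl⟩ := h
  exact ⟨(e.tensor (RingHom.id _)).comp h,
    congrArg (fun q : Hom B.poly C => q.comp h) (ev_tensor e 0),
    congrArg (fun q : Hom B.poly C => q.comp h) (ev_tensor e 1)⟩

namespace KK

variable {U : Underlying} {A B C : HAlg H c}

/-- The class `j(f)` of a homomorphism `f` in `kk(A, B)`. -/
noncomputable def ofHom (U : Underlying) (f : Hom A B) : KK U A B :=
  Quot.mk _ ⟨0, 0, (), (stabIncl B).comp f⟩

/-- The composition product `β ∘ j(f) ∈ kk(A, C)` of `f : A → B` and `β ∈ kk(B, C)`: it is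
represented by `Jⁿ(A) → Jⁿ(B) → M_• M_∞ C^{Sⁿ}`. -/
noncomputable def precomp (f : Hom A B) : KK U B C → KK U A C :=
  Quot.map (fun r => ⟨r.n, r.k, r.p, r.hom.comp (J.iterMap U r.n f)⟩) (by
    intro r r' h
    induction h with
    | homotopy g g' h => exact .homotopy _ _ (h.comp_right _)
    | trans hk hp g => exact .trans hk hp _
    | susp g =>
      have := KKRep.Rel.susp (g.comp (J.iterMap U _ f))
      rw [J.map_comp] at this
      exact this)

/-- The composition product `j(f) ∘ β ∈ kk(A, C)` of `β ∈ kk(A, B)` and `f : B → C`: it is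
represented by `Jⁿ(A) → M_• M_∞ B^{Sⁿ} → M_• M_∞ C^{Sⁿ}`. -/
noncomputable def postcomp (f : Hom B C) : KK U A B → KK U A C :=
  Quot.map (fun r => ⟨r.n, r.k, r.p, (stabMap r.k (sphereMap r.p f)).comp r.hom⟩) (by
    intro r r' h
    induction h with
    | homotopy g g' h => exact .homotopy _ _ (h.comp_left _)
    | @trans n k l p q hk hp g =>
      have := KKRep.Rel.trans hk hp ((stabMap k (sphereMap p f)).comp g)
      have e : ((stabTrans hk (sphere q C)).comp (stabMap k (sphereTrans hp C))).comp
          (stabMap k (sphereMap p f)) =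
          (stabMap l (sphereMap q f)).comp
            ((stabTrans hk (sphere q B)).comp (stabMap k (sphereTrans hp B))) := by
        have h1 := sphereTrans_natural hp f
        have h2 := stabTrans_natural hk (sphereMap q f)
        have h3 := congrArg (stabMap k) h1
        rw [stabMap_comp, stabMap_comp] at h3
        exact (congrArg (stabTrans hk (sphere q C)).comp h3).trans
          (congrArg (fun g => Hom.comp g (stabMap k (sphereTrans hp B))) h2)
      exact (congrArg (fun x => KKRep.Rel U A C ⟨n, k, p, (stabMap k (sphereMap p f)).comp g⟩
        ⟨n, l, q, x⟩) (congrArg (fun x => Hom.comp x g) e)).mp this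
    | @susp n k p g =>
      have := KKRep.Rel.susp ((stabMap k (sphereMap p f)).comp g)
      rw [J.map_comp] at this
      exact (congrArg (fun x => KKRep.Rel U A C ⟨n, k, p, (stabMap k (sphereMap p f)).comp g⟩
        ⟨n + 1, k, (0, p), x⟩) (congrArg (fun x => Hom.comp x (J.map U g))
          (stabRho_natural U k (sphereMap p f)).symm)).mp this)

end KK

/-- A homomorphism `f : A → B` is a kk-equivalence if `j(f)` is invertible in the category `kk`:
there is `β ∈ kk(B, A)` with `β ∘ j(f) = j(id)` and `j(f) ∘ β = j(id)`. -/
def IsKKEquiv (U : Underlying) {A B : HAlg H c} (f : Hom A B) : Prop :=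
  ∃ β : KK U B A, KK.precomp f β = KK.ofHom U (Hom.id A) ∧ KK.postcomp f β = KK.ofHom U (Hom.id B)

/-- `A` is kk-equivalent to zero, i.e. isomorphic to the zero algebra in `kk`.  As `kk(A, 0)` has the
single element `j(0)`, this means that `A → 0` is a kk-equivalence. -/
def KKEquivZero (U : Underlying) (A : HAlg H c) : Prop := IsKKEquiv U (Hom.zero A (zeroAlg H c))

/-! ### Gradings and nilpotent algebras -/

/-- A grading of an `H`-algebra by the natural numbers. -/
structure NGrading (A : HAlg H c) where
  piece : ℕ → AddSubgroup A
  smul_mem : ∀ n (h : H) a, a ∈ piece n → h • a ∈ piece n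
  op_smul_mem : ∀ n (h : H) a, a ∈ piece n → op h • a ∈ piece n
  mul_mem : ∀ m n a b, a ∈ piece m → b ∈ piece n → a * b ∈ piece (m + n)
  isInternal : DirectSum.IsInternal piece

/-- The subalgebra `A₀`. -/
def NGrading.zeroPart {A : HAlg H c} (𝒜 : NGrading A) : HAlg.Sub A where
  carrier := 𝒜.piece 0
  zero_mem' := (𝒜.piece 0).zero_mem
  add_mem' := (𝒜.piece 0).add_mem
  neg_mem' := (𝒜.piece 0).neg_mem
  mul_mem' := 𝒜.mul_mem 0 0 _ _
  smul_mem := 𝒜.smul_mem 0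
  op_smul_mem := 𝒜.op_smul_mem 0

namespace HAlg

/-- The additive subgroup `A^m` generated by the products of `m` elements of `A`, for `m ≥ 1`. -/
def powerGroup (A : HAlg H c) : ℕ → AddSubgroup A
  | 0 => ⊤
  | 1 => ⊤
  | m + 2 => AddSubgroup.closure {x | ∃ a b, b ∈ powerGroup A (m + 1) ∧ x = a * b}

theorem powerGroup_mul (A : HAlg H c) (m : ℕ) (a x : A) (hx : x ∈ A.powerGroup m) :
    a * x ∈ A.powerGroup m ∧ x * a ∈ A.powerGroup m := by
  induction m using Nat.strong_induction_on generalizing x with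
  | _ m ih =>
    match m with
    | 0 => exact ⟨trivial, trivial⟩
    | 1 => exact ⟨trivial, trivial⟩
    | m + 2 =>
      change x ∈ AddSubgroup.closure _ at hx
      induction hx using AddSubgroup.closure_induction with
      | mem x hx =>
        obtain ⟨y, b, hb, rfl⟩ := hx
        exact ⟨AddSubgroup.subset_closure ⟨a * y, b, hb, (mul_assoc a y b).symm⟩,
          AddSubgroup.subset_closure ⟨y, b * a, (ih (m + 1) (by omega) b hb).2, mul_assoc y b a⟩⟩
      | zero => rw [mul_zero, zero_mul]; exact ⟨zero_mem _, zero_mem _⟩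
      | add x y _ _ hx hy =>
        rw [mul_add, add_mul]; exact ⟨add_mem hx.1 hy.1, add_mem hx.2 hy.2⟩
      | neg x _ hx => rw [mul_neg, neg_mul]; exact ⟨neg_mem hx.1, neg_mem hx.2⟩

theorem powerGroup_smul (A : HAlg H c) (m : ℕ) (h : H) (x : A) (hx : x ∈ A.powerGroup m) :
    h • x ∈ A.powerGroup m ∧ op h • x ∈ A.powerGroup m := by
  induction m using Nat.strong_induction_on generalizing x with
  | _ m ih =>
    match m with
    | 0 => exact ⟨trivial, trivial⟩
    | 1 => exact ⟨trivial, trivial⟩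
    | m + 2 =>
      change x ∈ AddSubgroup.closure _ at hx
      induction hx using AddSubgroup.closure_induction with
      | mem x hx =>
        obtain ⟨y, b, hb, rfl⟩ := hx
        exact ⟨AddSubgroup.subset_closure ⟨h • y, b, hb, (A.smul_mul h y b).symm⟩,
          AddSubgroup.subset_closure ⟨y, op h • b, (ih (m + 1) (by omega) b hb).2,
            (A.mul_op_smul h y b).symm⟩⟩
      | zero => rw [smul_zero, smul_zero]; exact ⟨zero_mem _, zero_mem _⟩
      | add x y _ _ hx hy =>
        rw [smul_add, smul_add]; exact ⟨add_mem hx.1 hy.1, add_mem hx.2 hy.2⟩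
      | neg x _ hx => rw [smul_neg, smul_neg]; exact ⟨neg_mem hx.1, neg_mem hx.2⟩

/-- The power `A^m` as a subalgebra, for `m ≥ 1`. -/
def power (A : HAlg H c) (m : ℕ) : Sub A where
  carrier := A.powerGroup m
  zero_mem' := (A.powerGroup m).zero_mem
  add_mem' := (A.powerGroup m).add_mem
  neg_mem' := (A.powerGroup m).neg_mem
  mul_mem' {a b} _ hb := (A.powerGroup_mul m a b hb).1
  smul_mem h x hx := (A.powerGroup_smul m h x hx).1
  op_smul_mem h x hx := (A.powerGroup_smul m h x hx).2

/-- The ideal `A^m ∩ A^l` of `A^m`; it is `A^l` if `m ≤ l`. -/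
def powerIn (A : HAlg H c) (m l : ℕ) : Sub (A.power m).toHAlg := (A.power l).comap (A.power m).incl

theorem powerIn_isIdeal (A : HAlg H c) (m l : ℕ) : (A.powerIn m l).IsIdeal :=
  fun a x hx => A.powerGroup_mul l a.1 x.1 hx

/-- Nilpotent algebras: `A^m = 0` for some `m ≥ 1`. -/
def IsNilpotent (A : HAlg H c) : Prop := ∃ m, 0 < m ∧ ∀ a ∈ (A.power m).carrier, a = 0

/-- A nilpotent algebra `A` is `F`-nilpotent if all the quotient maps
`A^{2^n} → A^{2^n} / A^{2^{n+1}}` are `F`-split surjections. -/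
def IsFNilpotent (U : Underlying) (A : HAlg H c) : Prop :=
  A.IsNilpotent ∧
    ∀ n : ℕ, IsFSplit U ((A.powerIn (2 ^ n) (2 ^ (n + 1))).mkQ (A.powerIn_isIdeal _ _))

end HAlg

end AlgKK

namespace AlgKK

open HAlg

variable {H : Type u} [Ring H] {c : AlgClass H}

/-! ### Left exact sequences -/

/-! Part (1) is a homotopy argument. Sending `a` of degree `n` to `a tⁿ` defines a homomorphism `A →
A[t]`, because degrees add under multiplication just as exponents do. At `t = 1` it is the identity;
at `t = 0` it is the projection onto `A₀`, followed by the inclusion. The projection is thus inverse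
to the inclusion up to an elementary homotopy (`NGrading.elemHomotopic_incl_comp_proj`), and it is a
strict inverse on `A₀`.

Part (2) shows that every class in `kk(D, A)` is the class of a zero homomorphism if `A` is
nilpotent. Two facts carry it.

The first is about algebras `C` with zero multiplication. The path algebra of `C` again has zero
multiplication, so the section `a ↦ a ⊗ t` of the loop extension, being linear, is a homomorphism. A
split extension whose section is a homomorphism has zero classifying map, so `ρ` vanishes for `C`,
also after spheres and matrices are applied (`stabRho_eq_zero`).

The second is that `A ↦ M_k M_∞ A^{Sⁿ}` preserves kernels (`LeftExact.sphere`, `LeftExact.stab`).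
For tensor products this is flatness of the rings `ℤ^{Δⁿ}`; for simplicial powers and matrices it is
checked simplex by simplex and entry by entry.

Now let `f : Jⁿ(D) → M_k M_∞ A^{Sⁿ}` be a representative and `C = A / A²`. Its image under the
transition map of the colimit is `ρ ∘ J(f)`. By naturality of `ρ` this becomes zero in `C`, hence it
factors through the term for `A²` (`exists_susp_eq_comp_power_two`). One suspension therefore moves
a class from `A` to `A²`, whose nilpotency index is smaller, and induction ends at the zero algebra
(`KK.mk_eq_zero_of_powerGroup_eq_zero`). Applied to the identity of `A`, this gives `j(id) = j(0)`.
-/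

/-- The sequence `0 → L → S → C` is exact. -/
structure LeftExact {L S C : HAlg H c} (i : Hom L S) (q : Hom S C) : Prop where
  injective : Function.Injective i
  zero : ∀ x, q (i x) = 0
  exact : ∀ x, q x = 0 → ∃ y, i y = x

/-- The relation `∑ tᵢ = 1` can be solved for `t₀`, which makes the ring a retract of a polynomial
ring over `ℤ`; a retract of a free module is flat. -/
theorem simplexRing_flat (n : ℕ) : Module.Flat ℤ (SimplexRing n) := by
  -- The section of the quotient map: `t₀` goes to `1 - X₁ - ⋯ - Xₙ` and every other `tⱼ` to `Xⱼ`,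
  -- so that the images sum to `1`.
  let s : Fin (n + 1) → MvPolynomial (Fin (n + 1)) ℤ :=
    fun j => if j = 0 then 1 - ∑ k : Fin n, MvPolynomial.X k.succ else MvPolynomial.X j
  have hs : ∑ j, s j = 1 := by
    rw [Fin.sum_univ_succ]
    simp [s, Fin.succ_ne_zero]
  let r : MvPolynomial (Fin (n + 1)) ℤ →+* SimplexRing n :=
    Ideal.Quotient.mk (Ideal.span {(1 - ∑ i, MvPolynomial.X i : MvPolynomial (Fin (n + 1)) ℤ)})
  have hr : r.comp (SimplexRing.lift s hs) = RingHom.id _ := SimplexRing.hom_ext fun j => by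
    rw [RingHom.comp_apply, SimplexRing.lift_t, RingHom.id_apply]
    by_cases hj : j = 0
    · subst hj
      have h := SimplexRing.sum_t n
      rw [Fin.sum_univ_succ] at h
      simp only [s, if_true, map_sub, map_one, map_sum]
      rw [← h]
      exact add_sub_cancel_right _ _
    · simp only [s, if_neg hj]
      rfl
  refine Module.Flat.of_retract (SimplexRing.lift s hs).toAddMonoidHom.toIntLinearMap
    r.toAddMonoidHom.toIntLinearMap (LinearMap.ext fun x => ?_)
  exact congrArg (fun g => g x) hr

namespace LeftExact

variable {L S C : HAlg H c} {i : Hom L S} {q : Hom S C}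

/-- Left exactness concerns only the underlying abelian groups, so flatness of `R` over `ℤ` is all
that is needed. -/
theorem tensor (h : LeftExact i q) (R : Type) [CommRing R] [Module.Flat ℤ R] :
    LeftExact (i.tensor (RingHom.id R)) (q.tensor (RingHom.id R)) := by
  have hex : Function.Exact (AddMonoidHomClass.toAddMonoidHom i).toIntLinearMap
      (AddMonoidHomClass.toAddMonoidHom q).toIntLinearMap := fun x =>
    ⟨fun hx => h.exact x hx, fun ⟨y, hy⟩ => by rw [← hy]; exact h.zero y⟩
  have key := Module.Flat.rTensor_exact R hex
  refine ⟨?_, fun x => (key (i.tensor (RingHom.id R) x)).2 ⟨x, rfl⟩, fun x hx => (key x).1 hx⟩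
  exact Module.Flat.rTensor_preserves_injective_linearMap (M := R)
    (AddMonoidHomClass.toAddMonoidHom i).toIntLinearMap h.injective

/-- Kernels commute with the limit that defines `A^K`. Concretely, preimages are chosen at each
simplex; as they are unique, the chosen family is automatically compatible. -/
theorem pow (h : LeftExact i q) (K : SSet.{u}) :
    LeftExact (pow.map i K) (pow.map q K) := by
  have ht (n : ℕ) := haveI := simplexRing_flat n; h.tensor (SimplexRing n)
  refine ⟨fun φ ψ e => pow.ext fun n x => (ht _).injective (congrArg (fun f => pow.val f x) e),
    fun φ => pow.ext fun n x => (ht _).zero _, fun φ hφ => ?_⟩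
  have hex (n : SimplexCategoryᵒᵖ) (x : K.obj n) :=
    (ht _).exact (pow.val φ x) (congrArg (fun f => pow.val f x) hφ)
  refine ⟨⟨fun s => (hex s.1 s.2).choose, fun m n θ x => (ht _).injective ?_⟩,
    pow.ext fun n x => (hex n x).choose_spec⟩
  refine (hex n (K.map θ x)).choose_spec.trans ?_
  rw [pow.val_map]
  have e : (i.tensor (RingHom.id _)).comp ((Hom.id L).tensor (SimplexRing.map θ.unop)) =
      ((Hom.id S).tensor (SimplexRing.map θ.unop)).comp (i.tensor (RingHom.id _)) :=
    tensor_hom_ext fun _ _ => rfl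
  exact (congrArg ((Hom.id S).tensor (SimplexRing.map θ.unop)) (hex m x).choose_spec.symm).trans
    (congrArg (fun g : Hom _ _ => g (hex m x).choose) e).symm

/-- A preimage in `L^K` of an element vanishing on `K₀` also vanishes on `K₀`, because `L^{K₀} →
S^{K₀}` is injective. -/
theorem powRel (h : LeftExact i q) {K₀ K : SSet.{u}} (b : K₀ ⟶ K) :
    LeftExact (powRel.map i b) (powRel.map q b) := by
  refine ⟨fun φ ψ e => powRel.incl_injective b ((h.pow K).injective
      (congrArg (powRel.incl S b) e)),
    fun φ => powRel.incl_injective b ((h.pow K).zero (powRel.incl L b φ)), fun φ hφ => ?_⟩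
  obtain ⟨ψ, hψ⟩ := (h.pow K).exact (powRel.incl S b φ) (congrArg (powRel.incl C b) hφ)
  refine ⟨⟨ψ, (h.pow K₀).injective ?_⟩, powRel.incl_injective b hψ⟩
  rw [← pow.res_map, hψ, powRel.res_incl, map_zero (pow.map i K₀)]

theorem sphere (h : LeftExact i q) : {n : ℕ} → (p : SphereIndex n) →
    LeftExact (sphereMap p i) (sphereMap p q)
  | 0, _ => h
  | _ + 1, (_, p) => (h.sphere p).powRel _

theorem mat (h : LeftExact i q) (ι : Type) : LeftExact (Mat.map ι i) (Mat.map ι q) := by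
  classical
  refine ⟨fun x y e => MatCarrier.ext fun k l =>
      h.injective (congrArg (fun z : MatCarrier ι S => MatCarrier.entry z k l) e),
    fun x => MatCarrier.ext fun k l => h.zero _, fun x hx => ?_⟩
  -- A set-theoretic choice of preimages suffices, since it is only applied to entries in the kernel
  -- of `q`. The condition `g 0 = 0` keeps the resulting matrix finitely supported.
  let g : S → L := fun e => if he : ∃ k, i k = e then he.choose else 0
  have hg (e : S) (he : q e = 0) : i (g e) = e := by
    have h' := h.exact e he
    simp only [g, dif_pos h']
    exact h'.choose_spec
  have g0 : g 0 = 0 := h.injective ((hg 0 (map_zero q)).trans (map_zero i).symm)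
  exact ⟨MatCarrier.mapEntries g g0 x, MatCarrier.ext fun k l => hg _
    (congrArg (fun z : MatCarrier ι C => MatCarrier.entry z k l) hx)⟩

theorem stab (h : LeftExact i q) (k : ℕ) : LeftExact (stabMap k i) (stabMap k q) :=
  (h.mat ℕ).mat _

end LeftExact

theorem HAlg.Sub.leftExact {A : HAlg H c} (S : Sub A) (hS : S.IsIdeal) :
    LeftExact S.incl (S.mkQ hS) := by
  have key (x : A) : S.mkQ hS x = 0 ↔ x ∈ S.carrier :=
    QuotientAddGroup.eq_zero_iff (N := S.toNonUnitalSubring.toAddSubgroup) x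
  exact ⟨S.incl_injective, fun x => (key _).2 (S.incl_mem x), fun x hx => ⟨⟨x, (key x).1 hx⟩, rfl⟩⟩

/-! ### Algebras with zero multiplication -/

/-- All products in `A` vanish. -/
def HAlg.IsSquareZero (A : HAlg H c) : Prop := ∀ a b : A, a * b = 0

namespace HAlg.IsSquareZero

variable {A : HAlg H c}

theorem tensor (h : A.IsSquareZero) (R : Type) [CommRing R] : (A.tensor R).IsSquareZero := by
  intro x y
  induction x using tensor_induction with
  | h0 => exact zero_mul y
  | hadd x x' hx hx' => rw [add_mul, hx, hx', add_zero]
  | h a r =>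
    induction y using tensor_induction with
    | h0 => exact mul_zero (tmul a r)
    | hadd y y' hy hy' => rw [mul_add, hy, hy', add_zero]
    | h b s => rw [tmul_mul_tmul, h a b]; exact TensorProduct.zero_tmul _ _

theorem powRel (h : A.IsSquareZero) {K₀ K : SSet.{u}} (b : K₀ ⟶ K) :
    (A.powRel b).IsSquareZero := fun φ ψ =>
  powRel.incl_injective b (pow.ext fun _ x =>
    h.tensor _ (pow.val (powRel.incl A b φ) x) (pow.val (powRel.incl A b ψ) x))

theorem sphere (h : A.IsSquareZero) : {n : ℕ} → (p : SphereIndex n) → (sphere p A).IsSquareZero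
  | 0, _ => h
  | _ + 1, (_, p) => (h.sphere p).powRel _

theorem mat (h : A.IsSquareZero) (ι : Type) : (Mat ι A).IsSquareZero := by
  classical
  intro x y
  change MatCarrier.mulHom (x : MatCarrier ι A) (y : MatCarrier ι A) = 0
  -- The product is biadditive, so it vanishes once it vanishes on matrices with a single nonzero
  -- entry.
  have e : (MatCarrier.mulHom : MatCarrier ι A →+ MatCarrier ι A →+ MatCarrier ι A) = 0 :=
    MatCarrier.addHom_ext fun i j a => MatCarrier.addHom_ext fun k l b => by
      rw [MatCarrier.mulHom_single, h a b, map_zero, ite_self]; rfl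
  rw [e]; rfl

theorem stab (h : A.IsSquareZero) (k : ℕ) : (stab k A).IsSquareZero := (h.mat ℕ).mat _

end HAlg.IsSquareZero

/-! ### Vanishing of classifying maps -/

/-- If the section of a split extension is a homomorphism, then the classifying map vanishes. -/
theorem SplitExt.classify_eq_zero {U : Underlying} {K E C : HAlg H c} (X : SplitExt U K E C)
    (s : Hom C E) (hs : ∀ x, s x = X.s x) : X.classify = Hom.zero _ _ :=
  Hom.ext' fun x => X.injective <| by
    have h : X.liftT = s.comp (T.counit U C) := T.hom_ext fun a => (hs a).symm
    rw [X.i_classify, h, Hom.comp_apply, J.counit_incl, map_zero s]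
    exact (map_zero X.i).symm

/-- Entrywise, the section is `a ↦ a ⊗ t₁`. It is always bilinear over `H`, and here it is
multiplicative for the trivial reason that all products vanish in both its source and its target. -/
theorem stabRho_eq_zero (U : Underlying) (k : ℕ) {A : HAlg H c} (h : A.IsSquareZero) :
    stabRho U k A = Hom.zero _ _ := by
  let X := ((A.loopExt U).mat ℕ).mat (Fin (k + 1))
  refine X.classify_eq_zero
    { toFun := X.s
      -- `X.isHom` says nothing if `U` is the category of sets, so linearity is read off from the
      -- formula for the section.
      map_add' := fun x y => MatCarrier.ext fun _ _ => MatCarrier.ext fun _ _ =>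
        Subtype.ext (linePow_add _ _)
      map_mul' := fun x y => ?_
      map_smul' := fun r x => MatCarrier.ext fun _ _ => MatCarrier.ext fun _ _ =>
        Subtype.ext (pow.ext fun _ _ => (HAlg.smul_tmul r _ _).symm)
      map_op_smul' := fun r x => MatCarrier.ext fun _ _ => MatCarrier.ext fun _ _ =>
        Subtype.ext (pow.ext fun _ _ => (op_smul_tmul r _ _).symm) } fun _ => rfl
  -- The relative power along `coface 1` is the path algebra, which inherits the zero
  -- multiplication, as do matrices over it.
  have h1 : X.s x * X.s y = 0 := (h.powRel (coface 1)).stab k (X.s x) (X.s y)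
  rw [h1]
  exact (congrArg X.s (h.stab k x y)).trans X.s_zero

/-- This makes zero representatives in consecutive terms of the colimit agree in `kk`. It is not
formal: over sets, `T.map U` of a zero homomorphism sends each generator to the generator `of 0`,
which need not be `0`. The composite vanishes because the section preserves zero. -/
theorem SplitExt.classify_comp_map_zero {U : Underlying} {K E C D : HAlg H c}
    (X : SplitExt U K E C) : X.classify.comp (J.map U (Hom.zero D C)) = Hom.zero _ _ :=
  Hom.ext' fun x => X.injective <| by
    have h : X.liftT.comp (T.map U (Hom.zero D C)) = Hom.zero _ _ := T.hom_ext fun _ => X.s_zero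
    rw [Hom.comp_apply, X.i_classify, J.incl_map]
    exact (congrArg (fun g : Hom _ _ => g (J.incl U D x)) h).trans (map_zero X.i).symm

/-! ### Nilpotent algebras -/

theorem power_two_isIdeal (A : HAlg H c) : (A.power 2).IsIdeal :=
  fun a x hx => A.powerGroup_mul 2 a x hx

theorem quotient_power_two_isSquareZero (A : HAlg H c) :
    ((A.power 2).quotient (power_two_isIdeal A)).IsSquareZero := by
  rintro ⟨a⟩ ⟨b⟩
  exact (QuotientAddGroup.eq_zero_iff (N := (A.power 2).toNonUnitalSubring.toAddSubgroup)
    (a * b)).2 (AddSubgroup.subset_closure ⟨a, b, trivial, rfl⟩)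

/-- The first factor `A²` accounts for two factors of `A`, and each further one for at least one.
This crude bound already says that the nilpotency index drops by one on passing from `A` to `A²`,
which is what the induction uses. -/
theorem powerGroup_power_two (A : HAlg H c) (m : ℕ) (x : (A.power 2).toHAlg)
    (hx : x ∈ (A.power 2).toHAlg.powerGroup (m + 1)) : x.1 ∈ A.powerGroup (m + 2) := by
  induction m generalizing x with
  | zero => exact x.2
  | succ m ih =>
    change x ∈ AddSubgroup.closure _ at hx
    induction hx using AddSubgroup.closure_induction with
    | mem x hx =>
      obtain ⟨a, b, hb, rfl⟩ := hx
      exact AddSubgroup.subset_closure ⟨a.1, b.1, ih b hb, rfl⟩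
    | zero => exact zero_mem _
    | add x y _ _ hx hy => exact add_mem hx hy
    | neg x _ hx => exact neg_mem hx

/-- For `C = A / A²`, the suspension of an element of `kk(D, A)` is killed in `C`, hence it comes
from `A²`. -/
theorem exists_susp_eq_comp_power_two {U : Underlying} {A X : HAlg H c} {n k : ℕ}
    (p : SphereIndex n) (f : Hom X (stab k (sphere p A))) :
    ∃ g : Hom (J U X) (stab k (sphere (n := n + 1) (0, p) (A.power 2).toHAlg)),
      (stabRho U k (sphere p A)).comp (J.map U f) =
        (stabMap k (sphereMap (n := n + 1) (0, p) (A.power 2).incl)).comp g := by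
  let q := (A.power 2).mkQ (power_two_isIdeal A)
  have hex := (((A.power 2).leftExact (power_two_isIdeal A)).sphere (n := n + 1) (0, p)).stab k
  -- Naturality of `ρ` along `A → A / A²`; the side that contains `ρ` of the quotient is zero.
  have hq := stabRho_natural U k (sphereMap p q)
  rw [stabRho_eq_zero U k ((quotient_power_two_isSquareZero A).sphere p)] at hq
  let F := (stabRho U k (sphere p A)).comp (J.map U f)
  -- The values of `F` die in the term for `A / A²`, so by left exactness they lie in the image of
  -- the term for `A²`.
  have hF (x) : ∃ y, stabMap k (sphereMap (n := n + 1) (0, p) (A.power 2).incl) y = F x :=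
    hex.exact _ (congrArg (fun g : Hom _ _ => g (J.map U f x)) hq)
  exact ⟨Hom.factor _ hex.injective F hF,
    Hom.ext' fun x => (Hom.factor_spec _ hex.injective F hF x).symm⟩

/-- Each suspension replaces `A` by `A²` and raises `n` by one, so the induction on the nilpotency
index must allow both to vary. It ends after finitely many suspensions, which the colimit over `n`
permits. -/
theorem KK.mk_eq_zero_of_powerGroup_eq_zero {U : Underlying} (m : ℕ) {A D : HAlg H c}
    (hA : ∀ a ∈ A.powerGroup (m + 1), a = 0) {n k : ℕ} (p : SphereIndex n)
    (f : Hom (J.iter U n D) (stab k (sphere p A))) :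
    (Quot.mk _ ⟨n, k, p, f⟩ : KK U D A) = Quot.mk _ ⟨n, k, p, Hom.zero _ _⟩ := by
  induction m generalizing A n with
  | zero =>
    -- Here `A = A¹ = 0`. Exactness of `0 → A → A → A` with both maps the identity encodes this, and
    -- `sphere` and `stab` transport it to the target of `f`.
    have h : LeftExact (Hom.id A) (Hom.id A) :=
      ⟨fun _ _ h => h, fun x => hA x trivial, fun x _ => ⟨x, rfl⟩⟩
    have h' := (h.sphere p).stab k
    have hf : f = Hom.zero _ _ := Hom.ext' fun x => h'.injective <| h'.injective <|
      (h'.zero _).trans (h'.zero _).symm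
    rw [hf]
  | succ m ih =>
    let p' : SphereIndex (n + 1) := (0, p)
    obtain ⟨g, hg⟩ := exists_susp_eq_comp_power_two (U := U) p f
    have hcongr {z w : Hom (J.iter U (n + 1) D) (stab k (sphere p' A))} (h : z = w) :
        (Quot.mk _ ⟨n + 1, k, p', z⟩ : KK U D A) = Quot.mk _ ⟨n + 1, k, p', w⟩ := by rw [h]
    -- The zero homomorphism suspends to the zero homomorphism.
    have h0 : (Quot.mk _ ⟨n, k, p, Hom.zero _ _⟩ : KK U D A) =
        Quot.mk _ ⟨n + 1, k, p', Hom.zero _ _⟩ :=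
      (Quot.sound (.susp _)).trans (hcongr (SplitExt.classify_comp_map_zero _))
    have h1 := ih (A := (A.power 2).toHAlg)
      (fun a ha => Subtype.ext (hA a.1 (powerGroup_power_two A m a ha))) p' g
    have h2 : (Quot.mk _ ⟨n + 1, k, p', (stabMap k (sphereMap p' (A.power 2).incl)).comp g⟩ :
        KK U D A) = Quot.mk _ ⟨n + 1, k, p', _⟩ :=
      congrArg (KK.postcomp (A.power 2).incl) h1
    -- Writing `ι` for the inclusion of `A²`, the chain is `[f] = [ρ ∘ J(f)] = ι_*[g] = ι_*[0] =
    -- [0]`, the last zero being brought back from level `n + 1` to level `n`.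
    refine (Quot.sound (.susp f)).trans ((hcongr hg).trans (h2.trans (Eq.trans ?_ h0.symm)))
    exact hcongr (Hom.ext' fun x => map_zero (stabMap k (sphereMap p' (A.power 2).incl)))

/-- The inverse is the class of `0 → A`. On `A`, both the composite and `j(id)` equal the zero
class; on the zero algebra, any two homomorphisms agree. -/
theorem HAlg.IsNilpotent.kkEquivZero (U : Underlying) {A : HAlg H c} (hA : A.IsNilpotent) :
    KKEquivZero U A := by
  obtain ⟨m, hm, h⟩ := hA
  obtain ⟨m, rfl⟩ := Nat.exists_eq_add_of_lt hm
  rw [Nat.zero_add] at h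
  refine ⟨KK.ofHom U (Hom.zero _ _), ?_, congrArg (Quot.mk _) ?_⟩
  · exact (KK.mk_eq_zero_of_powerGroup_eq_zero m h (n := 0) (k := 0) () _).trans
      (KK.mk_eq_zero_of_powerGroup_eq_zero m h (n := 0) (k := 0) () _).symm
  · have he {B : HAlg H c} (f g : Hom (zeroAlg H c) B) : f = g := Hom.ext' fun a =>
      (map_zero f).trans (map_zero g).symm
    exact congrArg (fun f => (⟨0, 0, (), f⟩ : KKRep U (zeroAlg H c) (zeroAlg H c))) (he _ _)

/-! ### Graded algebras -/

namespace NGrading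

variable {A : HAlg H c} (𝒜 : NGrading A)

theorem induction {P : A → Prop} (h0 : P 0) (h : ∀ n, ∀ a ∈ 𝒜.piece n, P a)
    (hadd : ∀ x y, P x → P y → P (x + y)) (x : A) : P x := by
  obtain ⟨y, rfl⟩ := 𝒜.isInternal.2 x
  induction y using DirectSum.induction_on with
  | zero => rw [map_zero]; exact h0
  | of n a => rw [DirectSum.coeAddMonoidHom_of]; exact h n a a.2
  | add x y hx hy => rw [map_add]; exact hadd _ _ hx hy

/-- The additive map `a ↦ a tⁿ` on the elements of degree `n`. -/
noncomputable def scalePiece (n : ℕ) : 𝒜.piece n →+ A.poly where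
  toFun a := tmul a.1 (Polynomial.X ^ n)
  map_zero' := TensorProduct.zero_tmul _ _
  map_add' a b := TensorProduct.add_tmul a.1 b.1 _

/-- The additive map `A → A[t]` with `a ↦ a tⁿ` for `a` of degree `n`. -/
noncomputable def scaleAddHom : A →+ A.poly :=
  (DirectSum.toAddMonoid 𝒜.scalePiece).comp
    (AddEquiv.ofBijective (DirectSum.coeAddMonoidHom 𝒜.piece) 𝒜.isInternal).symm.toAddMonoidHom

theorem scaleAddHom_apply (n : ℕ) (a : A) (ha : a ∈ 𝒜.piece n) :
    𝒜.scaleAddHom a = tmul a (Polynomial.X ^ n) := by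
  have h : (AddEquiv.ofBijective (DirectSum.coeAddMonoidHom 𝒜.piece) 𝒜.isInternal).symm a =
      DirectSum.of (fun n => 𝒜.piece n) n ⟨a, ha⟩ :=
    (AddEquiv.symm_apply_eq _).2 (DirectSum.coeAddMonoidHom_of 𝒜.piece n ⟨a, ha⟩).symm
  exact (congrArg (DirectSum.toAddMonoid 𝒜.scalePiece) h).trans
    (DirectSum.toAddMonoid_of 𝒜.scalePiece n ⟨a, ha⟩)

/-- The homomorphism `A → A[t]` with `a ↦ a tⁿ` for `a` of degree `n`. -/
noncomputable def scale : Hom A A.poly where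
  toFun := 𝒜.scaleAddHom
  map_add' := map_add 𝒜.scaleAddHom
  map_mul' x y := by
    induction x using 𝒜.induction with
    | h0 => rw [zero_mul, map_zero, zero_mul]
    | hadd x x' hx hx' => rw [add_mul, map_add, hx, hx', map_add, add_mul]
    | h m a ha =>
      induction y using 𝒜.induction with
      | h0 => rw [mul_zero, map_zero, mul_zero]
      | hadd y y' hy hy' => rw [mul_add, map_add, hy, hy', map_add, mul_add]
      | h n b hb =>
        -- For homogeneous elements this is `a tᵐ · b tⁿ = ab t^{m+n}`, with `ab` of degree `m + n`.
        rw [𝒜.scaleAddHom_apply _ _ ha, 𝒜.scaleAddHom_apply _ _ hb,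
          𝒜.scaleAddHom_apply _ _ (𝒜.mul_mem m n a b ha hb), tmul_mul_tmul, pow_add]
  map_smul' h x := by
    induction x using 𝒜.induction with
    | h0 => rw [smul_zero, map_zero, smul_zero]
    | hadd x x' hx hx' => rw [smul_add, map_add, hx, hx', map_add, smul_add]
    | h n a ha =>
      rw [𝒜.scaleAddHom_apply _ _ ha, 𝒜.scaleAddHom_apply _ _ (𝒜.smul_mem n h a ha),
        HAlg.smul_tmul]
  map_op_smul' h x := by
    induction x using 𝒜.induction with
    | h0 => rw [smul_zero, map_zero, smul_zero]
    | hadd x x' hx hx' => rw [smul_add, map_add, hx, hx', map_add, smul_add]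
    | h n a ha =>
      rw [𝒜.scaleAddHom_apply _ _ ha, 𝒜.scaleAddHom_apply _ _ (𝒜.op_smul_mem n h a ha),
        op_smul_tmul]

/-- The two values that matter are `k = 1`, which gives the identity, and `k = 0`, which by `0⁰ = 1`
keeps degree zero and kills all positive degrees. -/
theorem ev_scale (k : ℤ) (n : ℕ) (a : A) (ha : a ∈ 𝒜.piece n) :
    A.ev k (𝒜.scale a) = k ^ n • a := by
  refine (congrArg (A.ev k) (𝒜.scaleAddHom_apply n a ha)).trans ?_
  refine (tensorEval_tmul _ _ _).trans ?_
  simp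

theorem ev_one_comp_scale : (A.ev 1).comp 𝒜.scale = Hom.id A := Hom.ext' fun x => by
  induction x using 𝒜.induction with
  | h0 => rw [map_zero ((A.ev 1).comp 𝒜.scale), map_zero (Hom.id A)]
  | hadd x y hx hy => rw [map_add ((A.ev 1).comp 𝒜.scale), hx, hy, map_add (Hom.id A)]
  | h n a ha => rw [Hom.comp_apply, 𝒜.ev_scale _ n a ha, one_pow, one_smul, Hom.id_apply]

theorem ev_zero_scale_mem (x : A) : (A.ev 0).comp 𝒜.scale x ∈ 𝒜.zeroPart.carrier := by
  induction x using 𝒜.induction with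
  | h0 => rw [map_zero ((A.ev 0).comp 𝒜.scale)]; exact (𝒜.piece 0).zero_mem
  | hadd x y hx hy =>
    rw [map_add ((A.ev 0).comp 𝒜.scale)]; exact (𝒜.piece 0).add_mem hx hy
  | h n a ha =>
    rw [Hom.comp_apply, 𝒜.ev_scale _ n a ha]
    rcases n with _ | n
    · rw [pow_zero, one_smul]; exact ha
    · rw [zero_pow n.succ_ne_zero, zero_smul]; exact (𝒜.piece 0).zero_mem

/-- The projection `A → A₀`. -/
noncomputable def proj : Hom A 𝒜.zeroPart.toHAlg :=
  𝒜.zeroPart.codRestrict ((A.ev 0).comp 𝒜.scale) 𝒜.ev_zero_scale_mem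

theorem proj_comp_incl : 𝒜.proj.comp 𝒜.zeroPart.incl = Hom.id _ :=
  Hom.ext' fun a => 𝒜.zeroPart.incl_injective <|
    (𝒜.ev_scale 0 0 a.1 a.2).trans (by rw [pow_zero, one_smul]; rfl)

/-- The homotopy is `scale`. Its end at `0` is the projection followed by the inclusion by the
definition of `proj`. -/
theorem elemHomotopic_incl_comp_proj :
    ElemHomotopic (𝒜.zeroPart.incl.comp 𝒜.proj) (Hom.id A) :=
  ⟨𝒜.scale, rfl, 𝒜.ev_one_comp_scale⟩

end NGrading

/-! ### Classes of homomorphisms in `kk` -/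

theorem KK.precomp_ofHom {U : Underlying} {A B C : HAlg H c} (f : Hom A B) (g : Hom B C) :
    KK.precomp f (KK.ofHom U g) = KK.ofHom U (g.comp f) := rfl

/-- Unlike precomposition, which leaves the target alone, this needs the corner inclusion `B → M_1
M_∞ B` to be natural in `B`, one matrix layer at a time. -/
theorem KK.postcomp_ofHom {U : Underlying} {A B C : HAlg H c} (f : Hom A B) (g : Hom B C) :
    KK.postcomp g (KK.ofHom U f) = KK.ofHom U (g.comp f) := by
  have h : (stabMap 0 g).comp (stabIncl B) = (stabIncl C).comp g := by
    have h1 := congrArg (Hom.comp · (Mat.corner 0 B))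
      (Mat.map_corner (0 : Fin 1) (Mat.map ℕ g))
    have h2 := congrArg (Hom.comp (Mat.corner (0 : Fin 1) (Mat ℕ C)))
      (Mat.map_corner (0 : ℕ) g)
    exact h1.trans h2
  exact congrArg (fun e : Hom B (stab 0 C) =>
    (Quot.mk _ ⟨0, 0, (), e.comp f⟩ : KK U A C)) h

theorem KK.ofHom_eq_of_elemHomotopic {U : Underlying} {A B : HAlg H c} {f g : Hom A B}
    (h : ElemHomotopic f g) : KK.ofHom U f = KK.ofHom U g :=
  Quot.sound (.homotopy (n := 0) (k := 0) (p := ()) _ _ (h.comp_left (stabIncl B)))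

/-- The inverse is `j` of the projection: one composite is the identity on the nose, the other after
an elementary homotopy. -/
theorem NGrading.isKKEquiv_incl (U : Underlying) {A : HAlg H c} (𝒜 : NGrading A) :
    IsKKEquiv U 𝒜.zeroPart.incl :=
  ⟨KK.ofHom U 𝒜.proj, by rw [KK.precomp_ofHom, 𝒜.proj_comp_incl], by
    rw [KK.postcomp_ofHom]
    exact KK.ofHom_eq_of_elemHomotopic 𝒜.elemHomotopic_incl_comp_proj⟩

end AlgKK

theorem mainTheorem11 {H : Type u} [Ring H] (c : AlgKK.AlgClass H) (U : AlgKK.Underlying) :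
    (∀ (A : AlgKK.HAlg H c) (𝒜 : AlgKK.NGrading A), AlgKK.IsKKEquiv U 𝒜.zeroPart.incl) ∧
    (∀ A : AlgKK.HAlg H c, A.IsFNilpotent U → AlgKK.KKEquivZero U A) :=
  ⟨fun _ 𝒜 => 𝒜.isKKEquiv_incl U, fun _ hA => hA.1.kkEquivZero U⟩
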